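/- Let $(X,d)$ be a metric space. Write $B(x,r)=\{y : d(x,y)\le r\}$, and for a collection $\mathcal U$ of subsets of $X$ let $\operatorname{mesh}(\mathcal U)$ be the supremum of the diameters of its elements and let the Lebesgue number $L(\mathcal U)$ be the supremum of all $r\ge 0$ such that every ball $B(x,r)$ is contained in some $U\in\mathcal U$. A function $D:\mathbb R_+\to\mathbb R_+$ is an $n$-dimensional control function for $(X,d)$ if for every $r>0$ there is a cover $\mathcal U=\bigcup_{i=1}^{n+1}\mathcal U_i$ of $X$ such that $\operatorname{mesh}(\mathcal U)\le D(r)$, $L(\mathcal U)\ge r$, and for each $i$ the elements of $\mathcal U_i$ are pairwise disjoint. The asymptotic dimension of $(X,d)$ is the smallest integer $n\ge 0$ for which an $n$-dimensional control function exists; the Assouad–Nagata dimension of $(X,d)$ is the smallest integer $n\ge 0$ for which $D(r)=Kr$ is an $n$-dimensional control function for some $K>1$. The same definitions apply when infinite distances are allowed; in particular a graph is regarded as a metric space on its vertex set with the shortest-path distance (infinite between different components), and the asymptotic dimension of a class of graphs is the asymptotic dimension of the disjoint union of all graphs in the class. The intersection graph of a system $\mathcal S$ of sets has vertex set $\mathcal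 S$, two distinct $S_1,S_2\in\mathcal S$ being adjacent if and only if $S_1\cap S_2\ne\emptyset$. For $f:\mathbb R_+\to\mathbb Z_+$, a system $\mathcal S$ of subsets of $X$ is $f$-space-filling if every $S\in\mathcal S$ has finite diameter and, for all $r,s>0$ and $x\in X$, the ball $B(x,r)$ is intersected by at most $f(r/s)$ pairwise disjoint elements of $\mathcal S$ of diameter at least $s$. Theorem. Let $(X,d)$ be a metric space of Assouad–Nagata dimension $n$, where $n\ge 0$ is an integer, and let $f:\mathbb R_+\to\mathbb Z_+$ be any function (here $\mathbb R_+$ and $\mathbb Z_+$ are the non-negative reals and integers). Then the class of intersection graphs of $f$-space-filling systems of subsets of $X$ has asymptotic dimension at most $2n+1$. -/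

import Mathlib

open scoped NNReal ENNReal

namespace CoarseDim

/-- The Lebesgue number of a collection `𝒰` of subsets: the supremum (in `[0, ∞]`) of the `r ≥ 0`
such that every ball of radius `r` is contained in some member of `𝒰`. -/
noncomputable def lebesgueNumber {X : Type*} [PseudoEMetricSpace X] (𝒰 : Set (Set X)) : ℝ≥0∞ :=
  ⨆ (r : ℝ≥0) (_ : ∀ x : X, ∃ U ∈ 𝒰, Metric.closedEBall x (r : ℝ≥0∞) ⊆ U), (r : ℝ≥0∞)

/-- The mesh of a collection `𝒰` of subsets: the supremum of the diameters of its members. -/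
noncomputable def mesh {X : Type*} [PseudoEMetricSpace X] (𝒰 : Set (Set X)) : ℝ≥0∞ :=
  ⨆ U ∈ 𝒰, Metric.ediam U

/-- `D` is an `n`-dimensional control function for `X`: for all `r > 0` there is a cover
`𝒰 = 𝒰₀ ∪ ⋯ ∪ 𝒰ₙ` of `X` with mesh at most `D r`, Lebesgue number at least `r`, and each `𝒰ᵢ`
consisting of pairwise disjoint sets. Distances in `X` may be infinite. -/
def IsControlFunction (X : Type*) [PseudoEMetricSpace X] (n : ℕ) (D : ℝ≥0 → ℝ≥0) : Prop :=
  ∀ r : ℝ≥0, 0 < r → ∃ 𝒰 : Fin (n + 1) → Set (Set X),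
    (⋃₀ ⋃ i, 𝒰 i) = Set.univ ∧
    mesh (⋃ i, 𝒰 i) ≤ (D r : ℝ≥0∞) ∧
    (r : ℝ≥0∞) ≤ lebesgueNumber (⋃ i, 𝒰 i) ∧
    ∀ i, (𝒰 i).PairwiseDisjoint id

/-- The asymptotic dimension: the smallest `n` for which an `n`-dimensional control function exists
(`⊤` if there is none). -/
noncomputable def asdim (X : Type*) [PseudoEMetricSpace X] : ℕ∞ :=
  ⨅ (n : ℕ) (_ : ∃ D : ℝ≥0 → ℝ≥0, IsControlFunction X n D), (n : ℕ∞)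

/-- The Assouad–Nagata dimension: the smallest `n` for which some linear function `r ↦ K * r` with
`K > 1` is an `n`-dimensional control function (`⊤` if there is none). -/
noncomputable def asdimAN (X : Type*) [PseudoEMetricSpace X] : ℕ∞ :=
  ⨅ (n : ℕ) (_ : ∃ K : ℝ≥0, 1 < K ∧ IsControlFunction X n (fun r => K * r)), (n : ℕ∞)

/-- The shortest-path metric on the vertices of a graph; vertices in different components are at
distance `∞`. -/
@[reducible] noncomputable def graphMetric {V : Type*} (G : SimpleGraph V) :
    PseudoEMetricSpace V where
  edist u v := (G.edist u v : ℝ≥0∞)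
  edist_self u := by simp
  edist_comm u v := by rw [G.edist_comm]
  edist_triangle u v w := by
    rw [← ENat.toENNReal_add]
    exact ENat.toENNReal_mono SimpleGraph.edist_triangle

/-- The disjoint union of a family of graphs. -/
def disjointUnion {ι : Type*} {V : ι → Type*} (G : ∀ i, SimpleGraph (V i)) :
    SimpleGraph (Σ i, V i) :=
  ⨆ i, (G i).map (Function.Embedding.sigmaMk i)

/-- The asymptotic dimension of a class of graphs, given as a family: the asymptotic dimension of
the disjoint union of all its graphs, with the shortest-path metric. -/
noncomputable def graphClassAsdim {ι : Type*} {V : ι → Type*} (G : ∀ i, SimpleGraph (V i)) : ℕ∞ :=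
  @asdim (Σ i, V i) (graphMetric (disjointUnion G))

/-- The intersection graph of a system of sets: its vertices are the members of the system, and two
distinct members are adjacent when they intersect. -/
def intersectionGraph {X : Type*} (𝒮 : Set (Set X)) : SimpleGraph 𝒮 where
  Adj S T := S ≠ T ∧ ((S : Set X) ∩ (T : Set X)).Nonempty
  symm := ⟨fun _ _ h => ⟨h.1.symm, by rw [Set.inter_comm]; exact h.2⟩⟩
  loopless := ⟨fun _ h => h.1 rfl⟩

/-- A system `𝒮` of subsets of `X` is `f`-space-filling: all members have finite diameter and, for
all `r, s > 0`, every ball of radius `r` is intersected by at most `f (r / s)` pairwise disjoint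
members of diameter at least `s`. -/
def IsSpaceFilling {X : Type*} [PseudoEMetricSpace X] (f : ℝ≥0 → ℕ) (𝒮 : Set (Set X)) : Prop :=
  (∀ S ∈ 𝒮, Metric.ediam S ≠ ⊤) ∧
  ∀ r s : ℝ≥0, 0 < r → 0 < s → ∀ x : X, ∀ 𝒯 ⊆ 𝒮, 𝒯.PairwiseDisjoint id →
    (∀ T ∈ 𝒯, (T ∩ Metric.closedEBall x (r : ℝ≥0∞)).Nonempty ∧ (s : ℝ≥0∞) ≤ Metric.ediam T) →
    𝒯.encard ≤ (f (r / s) : ℕ∞)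

end CoarseDim

/-! It suffices to find, for every `r`, `2 * (n + 1)` colours such that monochromatic chains of
`r`-close vertices have bounded diameter (`asdim_le_of_colouring`). The colours are pairs: `n + 1`
colours from the Assouad–Nagata dimension, times two from a tree-like structure.

The rank of a vertex is the logarithmic size of the largest member within graph distance `r`. A
vertex of rank `k` receives the colour that a chosen point of it has at a scale proportional to `σ
k`. Since the control function is linear and the `σ k` grow geometrically, monochromatic chains of
rank at most `k` spread over a distance of order `σ k` in `X` (`dist_le_of_clustered_chain`). The
components of rank at most `k`, for all `k`, are nested like a tree. Vertices in the bag of such a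
component are near members of diameter at least `σ k` meeting a ball of radius `q * σ k`, so space
filling covers the bag by `f q` sets of bounded graph diameter (`exists_index_of_isSpaceFilling`).

A graph with such bags needs two colours (`exists_colouring_of_hasThinBags`), by induction on the
number of covering sets. Inside a component, the maximal smaller components whose bags are far from
the top bag are coloured recursively; a collar of one colour next to a ring of the other keeps
chains from leaving their interior. In the remaining core, away from the top bag, every lower bag
has lost a covering set (`hasThinBags_core`), and the induction hypothesis applies. The core near
the top bag is coverable, and adding it back keeps chains bounded (`exists_chain_bound`). Passages
along collars of far components are replaced by links in their upper boundaries, so the bound is the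
same for all ranks (`isLayerColouring_of_core`). -/

namespace CoarseDim

open Relation

/-! ### Cutting chains, and sets covered by few sets of bounded diameter -/

/-- The part of a relation `S` that avoids the points satisfying `P`. -/
def Avoiding {α : Type*} (S : α → α → Prop) (P : α → Prop) (a b : α) : Prop :=
  S a b ∧ ¬ P a ∧ ¬ P b

/-- `Jump S P a b` holds when `a` and `b` are consecutive visits of an `S`-chain to `P`. -/
def Jump {α : Type*} (S : α → α → Prop) (P : α → Prop) (a b : α) : Prop :=
  P a ∧ P b ∧ (S a b ∨ ∃ y y', S a y ∧ ReflTransGen (Avoiding S P) y y' ∧ S y' b)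

/-- An `S`-chain either avoids `P`, or can be cut at its first and last visits to `P`. -/
theorem chain_avoids_or_visits {α : Type*} {S : α → α → Prop} (P : α → Prop) {u v : α}
    (h : ReflTransGen S u v) :
    ReflTransGen (Avoiding S P) u v ∨ ∃ z z', P z ∧ P z' ∧
      (u = z ∨ ∃ y, ReflTransGen (Avoiding S P) u y ∧ S y z) ∧
      ReflTransGen (Jump S P) z z' ∧
      (z' = v ∨ ∃ y, S z' y ∧ ¬ P y ∧ ReflTransGen (Avoiding S P) y v) := by
  induction h with
  | refl => exact Or.inl .refl
  | @tail v w _ hvw ih =>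
    rcases ih with h1 | ⟨z, z', hz, hz', h1, h2, h3⟩
    · by_cases hw : P w
      · exact Or.inr ⟨w, w, hw, hw, Or.inr ⟨v, h1, hvw⟩, .refl, Or.inl rfl⟩
      by_cases hv : P v
      · have : u = v := by
          rcases ReflTransGen.cases_tail h1 with h | ⟨y, _, hy⟩
          · exact h.symm
          · exact absurd hv hy.2.2
        exact Or.inr ⟨v, v, hv, hv, Or.inl this, .refl, Or.inr ⟨w, hvw, hw, .refl⟩⟩
      · exact Or.inl (h1.tail ⟨hvw, hv, hw⟩)
    · right
      by_cases hw : P w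
      · refine ⟨z, w, hz, hw, h1, h2.tail ⟨hz', hw, ?_⟩, Or.inl rfl⟩
        rcases h3 with rfl | ⟨y, hy, -, hyv⟩
        · exact Or.inl hvw
        · exact Or.inr ⟨y, v, hy, hyv, hvw⟩
      · refine ⟨z, z', hz, hz', h1, h2, Or.inr ?_⟩
        rcases h3 with rfl | ⟨y, hy, hPy, hyv⟩
        · exact ⟨w, hvw, hw, .refl⟩
        · have hv : ¬ P v := by
            rcases ReflTransGen.cases_tail hyv with rfl | ⟨_, _, hy'⟩
            · exact hPy
            · exact hy'.2.2
          exact ⟨y, hy, hPy, hyv.tail ⟨hvw, hv, hw⟩⟩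

/-- The relations `near k`, read as "at distance at most `k`", of an extended metric with integer
values. -/
structure IsNearness {α : Type*} (near : ℕ → α → α → Prop) : Prop where
  refl : ∀ a, near 0 a a
  symm : ∀ {k a b}, near k a b → near k b a
  trans : ∀ {k l a b c}, near k a b → near l b c → near (k + l) a c
  mono : ∀ {k l a b}, k ≤ l → near k a b → near l a b

/-- `B` is covered by `N` sets of diameter at most `ρ`. -/
def Coverable {α : Type*} (near : ℕ → α → α → Prop) (N ρ : ℕ) (B : Set α) : Prop :=
  ∃ g : α → ℕ, (∀ u ∈ B, g u < N) ∧ ∀ u ∈ B, ∀ v ∈ B, g u = g v → near ρ u v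

theorem Coverable.subset {α : Type*} {near : ℕ → α → α → Prop} {N ρ : ℕ} {A B : Set α}
    (h : Coverable near N ρ B) (hAB : A ⊆ B) : Coverable near N ρ A := by
  obtain ⟨g, h1, h2⟩ := h
  exact ⟨g, fun u hu => h1 u (hAB hu), fun u hu v hv => h2 u (hAB hu) v (hAB hv)⟩

theorem coverable_empty {α : Type*} (near : ℕ → α → α → Prop) (N ρ : ℕ) :
    Coverable near N ρ (∅ : Set α) :=
  ⟨fun _ => 0, by simp, by simp⟩

/-- Deleting everything close to a point of a covered set saves one of the covering sets. -/
theorem Coverable.of_far {α : Type*} {near : ℕ → α → α → Prop} {N ρ : ℕ} {A B : Set α}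
    (h : Coverable near (N + 1) ρ B) (hAB : A ⊆ B) {b : α} (hb : b ∈ B)
    (hfar : ∀ a ∈ A, ¬ near ρ a b) : Coverable near N ρ A := by
  obtain ⟨g, h1, h2⟩ := h
  have hne : ∀ u ∈ A, g u ≠ g b := fun u hu he => hfar u hu (h2 u (hAB hu) b hb he)
  -- The label of `b` is no longer used on `A`; larger labels move down by one to close the gap.
  refine ⟨fun u => if g u < g b then g u else g u - 1, fun u hu => ?_, fun u hu v hv he => ?_⟩
  · have := h1 u (hAB hu); have := h1 b hb; have := hne u hu
    dsimp only
    split_ifs <;> omega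
  · apply h2 u (hAB hu) v (hAB hv)
    have := hne u hu; have := hne v hv
    dsimp only at he
    split_ifs at he <;> omega

/-- If chains avoiding a coverable set `Z` are bounded, then all chains are. -/
theorem exists_chain_bound (s σ D : ℕ) (M : ℕ) : ∃ B : ℕ, ∀ {α : Type*}
    {near : ℕ → α → α → Prop} (_ : IsNearness near) {S : α → α → Prop}
    (_ : ∀ a b, S a b → near s a b) {Z : Set α} (_ : Coverable near M σ Z)
    (_ : ∀ u v, u ∉ Z → ReflTransGen (Avoiding S (· ∈ Z)) u v → near D u v) {u v : α},
    ReflTransGen S u v → near B u v := by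
  induction M with
  | zero =>
    refine ⟨D, fun {α near} hn {S} hS {Z} hZ hD {u v} huv => ?_⟩
    obtain ⟨g, h1, -⟩ := hZ
    have hZ : ∀ u, u ∉ Z := fun u hu => by simpa using h1 u hu
    exact hD u v (hZ u) (ReflTransGen.mono (fun a b hab => ⟨hab, hZ a, hZ b⟩) _ _ huv)
  | succ M ih =>
    obtain ⟨B, hB⟩ := ih
    -- Reach the piece labelled `M` for the first time, cross it at cost `σ`, and leave after the
    -- last visit. However often the chain returns in between, the two visits are `σ`-close.
    refine ⟨(B + s) + σ + (s + B), fun {α near} hn {S} hS {Z} hZ hD {u v} huv => ?_⟩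
    obtain ⟨g, h1, h2⟩ := hZ
    let P : α → Prop := fun a => a ∈ Z ∧ g a = M
    have key : ∀ {u v}, ReflTransGen (Avoiding S P) u v → near B u v := by
      intro u v h
      refine hB hn (S := Avoiding S P) (fun a b hab => hS a b hab.1)
        (Z := {a | a ∈ Z ∧ g a ≠ M}) ⟨g, ?_, ?_⟩ ?_ h
      · rintro a ⟨ha, hne⟩
        have := h1 a ha
        omega
      · exact fun a ha b hb => h2 a ha.1 b hb.1
      · intro u v hu h
        by_cases hP : P u
        · rcases ReflTransGen.cases_head h with rfl | ⟨_, h, _⟩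
          · exact hn.mono (Nat.zero_le _) (hn.refl _)
          · exact absurd hP h.1.2.1
        · have hoff : ∀ a, ¬ (a ∈ Z ∧ g a ≠ M) → ¬ P a → a ∉ Z := fun a h3 h4 h5 =>
            h4 ⟨h5, by_contra fun h6 => h3 ⟨h5, h6⟩⟩
          exact hD u v (hoff u hu hP)
            (ReflTransGen.mono (fun a b hab =>
              ⟨hab.1.1, hoff a hab.2.1 hab.1.2.1, hoff b hab.2.2 hab.1.2.2⟩) _ _ h)
    rcases chain_avoids_or_visits P huv with h | ⟨z, z', hz, hz', h3, -, h4⟩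
    · exact hn.mono (by omega) (key h)
    · have e1 : near (B + s) u z := by
        rcases h3 with rfl | ⟨y, hy, hyz⟩
        · exact hn.mono (Nat.zero_le _) (hn.refl _)
        · exact hn.trans (key hy) (hS _ _ hyz)
      have e2 : near (s + B) z' v := by
        rcases h4 with rfl | ⟨y, hy, -, hyz⟩
        · exact hn.mono (Nat.zero_le _) (hn.refl _)
        · exact hn.trans (hS _ _ hy) (key hyz)
      exact hn.trans (hn.trans e1 (h2 z hz.1 z' hz'.1 (hz.2.trans hz'.2.symm))) e2

theorem reflTransGen_symm {α : Type*} {S : α → α → Prop} (hS : ∀ a b, S a b → S b a) {u v : α}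
    (h : ReflTransGen S u v) : ReflTransGen S v u := by
  induction h with
  | refl => exact .refl
  | tail _ hbc ih => exact ReflTransGen.head (hS _ _ hbc) ih

/-! ### Components of bounded rank, their bags, and the core -/

section Bags

variable {α : Type*} (near : ℕ → α → α → Prop) (H : α → α → Prop) (rank : α → ℕ)

/-- `u` and `v` are joined by an `H`-chain through points of rank at most `k`. -/
def ConnLE (k : ℕ) : α → α → Prop :=
  ReflTransGen fun a b => H a b ∧ rank a ≤ k ∧ rank b ≤ k

/-- The points of rank above `k` that are adjacent to the component of `u` in rank at most `k`. -/
def upper (k : ℕ) (u : α) : Set α :=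
  {v | k < rank v ∧ ∃ w, rank w ≤ k ∧ ConnLE H rank k u w ∧ H w v}

/-- The points of rank `k` in the component of `u` in rank at most `k`, and the upper neighbours
of this component. -/
def bag (k : ℕ) (u : α) : Set α :=
  {v | rank v = k ∧ ConnLE H rank k u v} ∪ upper H rank k u

/-- All bags are covered by `N` sets of diameter at most `ρ`. -/
def HasThinBags (N ρ : ℕ) : Prop :=
  ∀ k u, rank u ≤ k → Coverable near N ρ (bag H rank k u)

/-- `u` has rank at most `k` and a neighbour of larger rank. -/
def Collar (k : ℕ) (u : α) : Prop :=
  rank u ≤ k ∧ ∃ a, k < rank a ∧ H u a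

/-- A two-colouring of the points of rank at most `k` with monochromatic chains bounded by `D`,
constant on the collar and changing colour next to it. -/
structure IsLayerColouring (D k : ℕ) (c : α → Bool) : Prop where
  collar : ∀ u, Collar H rank k u → c u = true
  ring : ∀ u x, rank u ≤ k → ¬ Collar H rank k u → H u x → Collar H rank k x → c u = false
  bdd : ∀ u v, ReflTransGen (fun a b => H a b ∧ rank a ≤ k ∧ rank b ≤ k ∧ c a = c b) u v →
    near D u v

/-- The component of `u` in rank at most `j` has its bag far from the bag at level `k`. -/
def IsFarLevel (Q k j : ℕ) (u : α) : Prop :=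
  j < k ∧ rank u ≤ j ∧ ∀ b ∈ bag H rank j u, ∀ a ∈ bag H rank k u, ¬ near Q b a

/-- `u` has rank at most `k` and belongs to no component whose bag is far from the bag at
level `k`. -/
def IsCore (Q k : ℕ) (u : α) : Prop :=
  rank u ≤ k ∧ ∀ j, ¬ IsFarLevel near H rank Q k j u

open Classical in
/-- The largest far level of `u`. -/
noncomputable def farLevel (Q k : ℕ) (u : α) : ℕ :=
  Nat.findGreatest (fun j => IsFarLevel near H rank Q k j u) k

/-- `H`-adjacency, together with adjacency of close points in the upper boundary of a common
far component. -/
def CoreLink (Q k r' : ℕ) (w w' : α) : Prop :=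
  near r' w w' ∧ (H w w' ∨ ∃ j x, IsFarLevel near H rank Q k j x ∧
    w ∈ upper H rank j x ∧ w' ∈ upper H rank j x)

end Bags

section BagLemmas

variable {α : Type*} {near : ℕ → α → α → Prop} {H : α → α → Prop} {rank : α → ℕ}

theorem ConnLE.mono {k l : ℕ} (hkl : k ≤ l) {u v : α} (h : ConnLE H rank k u v) :
    ConnLE H rank l u v :=
  ReflTransGen.mono (fun _ _ hab => ⟨hab.1, hab.2.1.trans hkl, hab.2.2.trans hkl⟩) _ _ h

theorem ConnLE.symm (hH : ∀ a b, H a b → H b a) {k : ℕ} {u v : α} (h : ConnLE H rank k u v) :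
    ConnLE H rank k v u :=
  reflTransGen_symm (fun a b hab => ⟨hH a b hab.1, hab.2.2, hab.2.1⟩) h

theorem ConnLE.trans {k : ℕ} {u v w : α} (h : ConnLE H rank k u v) (h' : ConnLE H rank k v w) :
    ConnLE H rank k u w :=
  ReflTransGen.trans h h'

theorem ConnLE.single {k : ℕ} {u v : α} (h : H u v) (hu : rank u ≤ k) (hv : rank v ≤ k) :
    ConnLE H rank k u v :=
  ReflTransGen.single ⟨h, hu, hv⟩

theorem ConnLE.rank_le {k : ℕ} {u v : α} (h : ConnLE H rank k u v) (hu : rank u ≤ k) :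
    rank v ≤ k := by
  rcases ReflTransGen.cases_tail h with rfl | ⟨_, _, h⟩
  · exact hu
  · exact h.2.2

theorem upper_congr (hH : ∀ a b, H a b → H b a) {k : ℕ} {u v : α} (h : ConnLE H rank k u v) :
    upper H rank k u = upper H rank k v := by
  ext x
  constructor
  · rintro ⟨h1, w, h2, h3, h4⟩
    exact ⟨h1, w, h2, (h.symm hH).trans h3, h4⟩
  · rintro ⟨h1, w, h2, h3, h4⟩
    exact ⟨h1, w, h2, h.trans h3, h4⟩

theorem bag_congr (hH : ∀ a b, H a b → H b a) {k : ℕ} {u v : α} (h : ConnLE H rank k u v) :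
    bag H rank k u = bag H rank k v := by
  unfold bag
  rw [upper_congr hH h]
  congr 1
  ext x
  exact ⟨fun hx => ⟨hx.1, (h.symm hH).trans hx.2⟩, fun hx => ⟨hx.1, h.trans hx.2⟩⟩

theorem mem_upper {k : ℕ} {u v : α} (hu : rank u ≤ k) (hv : k < rank v) (h : H u v) :
    v ∈ upper H rank k u :=
  ⟨hv, u, hu, .refl, h⟩

theorem upper_subset_bag {k : ℕ} {u : α} : upper H rank k u ⊆ bag H rank k u :=
  Set.subset_union_right

theorem IsFarLevel.congr (hH : ∀ a b, H a b → H b a) {Q k j : ℕ} {u v : α}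
    (h : IsFarLevel near H rank Q k j u) (huv : ConnLE H rank j u v) :
    IsFarLevel near H rank Q k j v := by
  refine ⟨h.1, huv.rank_le h.2.1, ?_⟩
  rw [← bag_congr hH huv, ← bag_congr hH (huv.mono h.1.le)]
  exact h.2.2

theorem isFarLevel_farLevel {Q k : ℕ} {u : α} (hu : rank u ≤ k)
    (h : ¬ IsCore near H rank Q k u) :
    IsFarLevel near H rank Q k (farLevel near H rank Q k u) u := by
  classical
  have : ∃ j, IsFarLevel near H rank Q k j u := by
    by_contra hc
    exact h ⟨hu, fun j hj => hc ⟨j, hj⟩⟩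
  obtain ⟨j, hj⟩ := this
  unfold farLevel
  convert! Nat.findGreatest_spec (P := fun j => IsFarLevel near H rank Q k j u) hj.1.le hj

theorem IsFarLevel.le_farLevel {Q k j : ℕ} {u : α} (h : IsFarLevel near H rank Q k j u) :
    j ≤ farLevel near H rank Q k u := by
  classical
  unfold farLevel
  exact Nat.le_findGreatest h.1.le h

/-- Far levels depend only on the component, and a larger far level of `v` would pass back to `u`.
Thus the maximal far components are well defined and disjoint. -/
theorem farLevel_congr (hH : ∀ a b, H a b → H b a) {Q k : ℕ} {u v : α}
    (h : IsFarLevel near H rank Q k (farLevel near H rank Q k u) u)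
    (huv : ConnLE H rank (farLevel near H rank Q k u) u v) :
    farLevel near H rank Q k v = farLevel near H rank Q k u := by
  have h1 := h.congr hH huv
  have h2 := isFarLevel_farLevel (h1.2.1.trans h.1.le) (fun hc => hc.2 _ h1)
  exact le_antisymm (h2.congr hH ((huv.mono h1.le_farLevel).symm hH)).le_farLevel h1.le_farLevel

/-- An added link joins two neighbours of a component whose ranks exceed its level, so it can be
rerouted through that component without raising the rank. Hence core links create no new connections
at any level. -/
theorem CoreLink.connLE (hH : ∀ a b, H a b → H b a) {Q k r' l : ℕ} {w w' : α}
    (h : CoreLink near H rank Q k r' w w') (hw : rank w ≤ l) (hw' : rank w' ≤ l) :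
    ConnLE H rank l w w' := by
  rcases h.2 with h | ⟨j, x, -, ⟨h1, y, hy, hxy, hyw⟩, -, y', hy', hxy', hyw'⟩
  · exact .single h hw hw'
  · have hjl : j ≤ l := by omega
    exact (((ConnLE.single (hH _ _ hyw) hw (hy.trans hjl)).trans
      ((hxy.mono hjl).symm hH)).trans (hxy'.mono hjl)).trans
      (.single hyw' (hy'.trans hjl) hw')

theorem connLE_of_coreLink (hH : ∀ a b, H a b → H b a) {Q k r' l : ℕ} {p : α → Prop}
    {u v : Subtype p} (h : ConnLE (fun a b : Subtype p => CoreLink near H rank Q k r' a b)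
      (fun a : Subtype p => rank a) l u v) : ConnLE H rank l (u : α) v := by
  induction h with
  | refl => exact .refl
  | tail _ hbc ih => exact ih.trans (hbc.1.connLE hH hbc.2.1 hbc.2.2)

theorem mem_bag_of_coreLink (hH : ∀ a b, H a b → H b a) {Q k r' l : ℕ} {p : α → Prop}
    {u v : Subtype p} (h : v ∈ bag (fun a b : Subtype p => CoreLink near H rank Q k r' a b)
      (fun a : Subtype p => rank a) l u) : (v : α) ∈ bag H rank l (u : α) := by
  rcases h with ⟨h1, h2⟩ | ⟨h1, w, h2, h3, h4⟩
  · exact Or.inl ⟨h1, connLE_of_coreLink hH h2⟩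
  · right
    have h3 := connLE_of_coreLink hH h3
    have h2 : rank (w : α) ≤ l := h2
    rcases h4.2 with h | ⟨j, x, -, ⟨hj, y, hy, hxy, hyw⟩, -, y', hy', hxy', hyw'⟩
    · exact ⟨h1, w, h2, h3, h⟩
    · have hjl : j ≤ l := by omega
      exact ⟨h1, y', hy'.trans hjl, h3.trans (((ConnLE.single (hH _ _ hyw) h2
        (hy.trans hjl)).trans ((hxy.mono hjl).symm hH)).trans (hxy'.mono hjl)), hyw'⟩

/-- Restricting to core points far from the top bag lowers the thickness of the bags. -/
theorem hasThinBags_core (hn : IsNearness near) (hH : ∀ a b, H a b → H b a) {N ρ Q k r' : ℕ}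
    (hthin : HasThinBags near H rank (N + 1) ρ) {p : α → Prop}
    (hp : ∀ u, p u ↔ IsCore near H rank Q k u ∧ ∀ a ∈ bag H rank k u, ¬ near (Q + ρ) u a) :
    HasThinBags (fun m (a b : Subtype p) => near m a b)
      (fun a b : Subtype p => CoreLink near H rank Q k r' a b) (fun a : Subtype p => rank a)
      N ρ := by
  have hlift : ∀ l (u : Subtype p), Coverable near N ρ
      (Subtype.val '' bag (fun a b : Subtype p => CoreLink near H rank Q k r' a b)
      (fun a : Subtype p => rank a) l u) → Coverable (fun m (a b : Subtype p) => near m a b) N ρ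
      (bag (fun a b : Subtype p => CoreLink near H rank Q k r' a b)
      (fun a : Subtype p => rank a) l u) := by
    rintro l u ⟨g, h1, h2⟩
    exact ⟨fun a => g a, fun a ha => h1 a ⟨a, ha, rfl⟩,
      fun a ha b hb => h2 a ⟨a, ha, rfl⟩ b ⟨b, hb, rfl⟩⟩
  intro l u hu
  have hcore : ∀ v : Subtype p, rank v ≤ k := fun v => ((hp v).1 v.2).1.1
  rcases lt_or_ge l k with hl | hl
  -- As `u` is in the core, level `l` is not far. Points of `p` stay `Q + ρ` away from the top bag,
  -- hence `ρ` away from `b`, and the covering set of `b` drops out.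
  · obtain ⟨b, hb, a, ha, hba⟩ : ∃ b ∈ bag H rank l (u : α), ∃ a ∈ bag H rank k (u : α),
        near Q b a := by
      by_contra hc
      push Not at hc
      exact ((hp u).1 u.2).1.2 l ⟨hl, hu, hc⟩
    refine hlift l u ((hthin l u hu).of_far (b := b) ?_ hb ?_)
    · rintro _ ⟨v, hv, rfl⟩
      exact mem_bag_of_coreLink hH hv
    · rintro _ ⟨v, hv, rfl⟩ hvb
      have huv : ConnLE H rank k (u : α) v := by
        rcases mem_bag_of_coreLink hH hv with h | ⟨h1, w, h2, h3, h4⟩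
        · exact h.2.mono hl.le
        · exact (h3.mono hl.le).trans (.single h4 (h2.trans hl.le) (hcore v))
      rw [bag_congr hH huv] at ha
      exact ((hp v).1 v.2).2 a ha (hn.mono (by omega) (hn.trans hvb hba))
  -- At level `k` and above, the only candidates are points of rank `k`, which lie in the top bag
  -- and are excluded by `p`.
  · refine (coverable_empty _ N ρ).subset ?_
    rintro v (⟨h1, h2⟩ | ⟨h1, -⟩)
    · have hv : (v : α) ∈ bag H rank k (v : α) :=
        Or.inl ⟨le_antisymm (hcore v) (hl.trans h1.ge), .refl⟩
      exact ((hp v).1 v.2).2 v hv (hn.mono (Nat.zero_le _) (hn.refl _))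
    · exact absurd ((hcore v).trans hl) (not_le.2 h1)

end BagLemmas

/-- Chains of `s`-close points inside `B`. -/
def ChainIn {α : Type*} (near : ℕ → α → α → Prop) (s : ℕ) (B : Set α) : α → α → Prop :=
  ReflTransGen fun p q => p ∈ B ∧ q ∈ B ∧ near s p q

/-- This is `exists_chain_bound` with `Z = B`: outside `B` a chain cannot move, so the bound there
is `0`. -/
theorem exists_chainIn_bound (s ρ N : ℕ) : ∃ C : ℕ, ∀ {α : Type*} {near : ℕ → α → α → Prop}
    (_ : IsNearness near) {B : Set α} (_ : Coverable near N ρ B) {u v : α},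
    ChainIn near s B u v → near C u v := by
  obtain ⟨C, hC⟩ := exists_chain_bound s ρ 0 N
  refine ⟨C, fun {α near} hn {B} hB {u v} huv => hC hn (fun a b hab => hab.2.2) hB ?_ huv⟩
  intro a b ha hab
  rcases ReflTransGen.cases_head hab with rfl | ⟨c, hc, -⟩
  · exact hn.refl _
  · exact absurd hc.1.1 ha

/-- Monochromatic chains in the core are bounded, once they are so away from the top bag. -/
theorem exists_core_chain_bound (N ρ Q r' D : ℕ) : ∃ C : ℕ, ∀ {α : Type*}
    {near : ℕ → α → α → Prop} (_ : IsNearness near) {H : α → α → Prop}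
    (_ : ∀ a b, H a b → H b a) {rank : α → ℕ} (_ : HasThinBags near H rank N ρ) {k : ℕ}
    {p : α → Prop}
    (_ : ∀ u, p u ↔ IsCore near H rank Q k u ∧ ∀ a ∈ bag H rank k u, ¬ near (Q + ρ) u a)
    {c : α → Bool} (_ : ∀ u v : Subtype p, ReflTransGen (fun a b : Subtype p =>
      CoreLink near H rank Q k r' (a : α) b ∧ c a = c b) u v → near D u v) {u v : α},
    ReflTransGen (fun a b => CoreLink near H rank Q k r' a b ∧ c a = c b ∧
      IsCore near H rank Q k a ∧ IsCore near H rank Q k b) u v → near C u v := by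
  obtain ⟨C, hC⟩ := exists_chain_bound r' ((Q + ρ) + ρ + (Q + ρ)) D N
  refine ⟨C, fun {α near} hn {H} hH {rank} hthin {k p} hp {c} hc {u v} huv => ?_⟩
  -- The chain stays in one component of rank at most `k`, so a single top bag is involved.
  have hconn : ReflTransGen (fun a b => CoreLink near H rank Q k r' a b ∧ c a = c b ∧
      IsCore near H rank Q k a ∧ IsCore near H rank Q k b ∧ ConnLE H rank k u a ∧
      ConnLE H rank k u b) u v ∧ ConnLE H rank k u v := by
    induction huv with
    | refl => exact ⟨.refl, .refl⟩
    | tail _ h ih =>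
      have := ih.2.trans (h.1.connLE hH h.2.2.1.1 h.2.2.2.1)
      exact ⟨ih.1.tail ⟨h.1, h.2.1, h.2.2.1, h.2.2.2, ih.2, this⟩, this⟩
  rcases ReflTransGen.cases_head huv with rfl | ⟨_, h, -⟩
  · exact hn.mono (Nat.zero_le _) (hn.refl _)
  have hu : rank u ≤ k := h.2.2.1.1
  refine hC hn (fun a b hab => hab.1.1)
    (Z := {x | IsCore near H rank Q k x ∧ ¬ p x ∧ ConnLE H rank k u x}) ?_ ?_ hconn.1
  -- A core point outside `p` is `Q + ρ`-close to the top bag and inherits the label of a nearby bag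
  -- point, whence the diameter `(Q + ρ) + ρ + (Q + ρ)`.
  · obtain ⟨g, h1, h2⟩ := hthin k u hu
    have : ∀ x, IsCore near H rank Q k x ∧ ¬ p x ∧ ConnLE H rank k u x →
        ∃ a ∈ bag H rank k u, near (Q + ρ) x a := by
      rintro x ⟨hx, hpx, hux⟩
      rw [hp] at hpx
      rw [bag_congr hH hux]
      by_contra hcon
      push Not at hcon
      exact hpx ⟨hx, hcon⟩
    choose! a ha hxa using this
    exact ⟨fun x => g (a x), fun x hx => h1 _ (ha x hx), fun x hx y hy hxy =>
      hn.trans (hn.trans (hxa x hx) (h2 _ (ha x hx) _ (ha y hy) hxy)) (hn.symm (hxa y hy))⟩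
  · intro x y hx hxy
    have hmem : ∀ z, IsCore near H rank Q k z → ConnLE H rank k u z →
        ¬ (IsCore near H rank Q k z ∧ ¬ p z ∧ ConnLE H rank k u z) → p z :=
      fun z h1 h2 h3 => by_contra fun h4 => h3 ⟨h1, h4, h2⟩
    rcases ReflTransGen.cases_head hxy with rfl | ⟨z, hz, -⟩
    · exact hn.mono (Nat.zero_le _) (hn.refl _)
    have hpx : p x := hmem x hz.1.2.2.1 hz.1.2.2.2.2.1 hx
    have : ∃ hy : p y, ReflTransGen (fun a b : Subtype p =>
        CoreLink near H rank Q k r' (a : α) b ∧ c a = c b) ⟨x, hpx⟩ ⟨y, hy⟩ := by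
      clear hz
      induction hxy with
      | refl => exact ⟨hpx, .refl⟩
      | tail _ h ih =>
        obtain ⟨hb, h'⟩ := ih
        exact ⟨hmem _ h.1.2.2.2.1 h.1.2.2.2.2.2 h.2.2, h'.tail ⟨h.1.1, h.1.2.1⟩⟩
    obtain ⟨hy, h⟩ := this
    exact hc _ _ h

/-! ### Extending the two-colouring from lower layers and the core to a layer -/

section Step

variable {α : Type*} {near : ℕ → α → α → Prop} {H : α → α → Prop} {rank : α → ℕ}

/-- `u` lies outside the core, on the collar of its largest far component. -/
def IsFarCollar (near : ℕ → α → α → Prop) (H : α → α → Prop) (rank : α → ℕ) (Q k : ℕ) (u : α) :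
    Prop :=
  rank u ≤ k ∧ ¬ IsCore near H rank Q k u ∧ Collar H rank (farLevel near H rank Q k u) u

theorem not_isCore_of_far {Q k j : ℕ} {u : α} (h : IsFarLevel near H rank Q k j u) :
    ¬ IsCore near H rank Q k u := fun hc => hc.2 _ h

theorem lt_rank_of_isCore (hH : ∀ a b, H a b → H b a) {Q k : ℕ} {u v : α}
    (hu : IsCore near H rank Q k u) (hvk : rank v ≤ k) (hv : ¬ IsCore near H rank Q k v)
    (huv : H v u) : farLevel near H rank Q k v < rank u := by
  by_contra hlt
  have hf := isFarLevel_farLevel hvk hv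
  exact not_isCore_of_far (hf.congr hH (.single huv hf.2.1 (not_lt.1 hlt))) hu

/-- Two maximal far components joined by an edge coincide: the one of higher level contains both
ends, and then the far levels agree. -/
theorem connLE_of_not_isCore (hH : ∀ a b, H a b → H b a) {Q k : ℕ} {u v : α}
    (huk : rank u ≤ k) (hu : ¬ IsCore near H rank Q k u) (hvk : rank v ≤ k)
    (hv : ¬ IsCore near H rank Q k v) (huv : H u v) :
    ConnLE H rank (farLevel near H rank Q k u) u v := by
  have hfu := isFarLevel_farLevel huk hu
  have hfv := isFarLevel_farLevel hvk hv
  have h1 := hfu.2.1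
  have h2 := hfv.2.1
  by_cases hle : rank v ≤ farLevel near H rank Q k u
  · exact .single huv h1 hle
  by_cases hle' : rank u ≤ farLevel near H rank Q k v
  · have := farLevel_congr hH hfv (.single (hH _ _ huv) h2 hle')
    omega
  · omega

/-- The colouring of a layer by a colouring `cW` of the core far from the top bag and the
colourings `cj` of the lower layers. -/
theorem isLayerColouring_of_core (hn : IsNearness near) (hH : ∀ a b, H a b → H b a)
    {ρ r r' B C D k : ℕ} (hHr : ∀ a b, H a b → near r a b)
    (hrr' : r ≤ r') (hBr' : B ≤ r')
    (hD : (r + B) + (C + (B + r)) ≤ D)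
    (hB : ∀ {j : ℕ} {x : α}, rank x ≤ j → ∀ {u v : α},
      ChainIn near (r + r + r) (upper H rank j x) u v → near B u v)
    {p : α → Prop} (hp : ∀ u, p u ↔ IsCore near H rank (r + r) k u ∧
      ∀ a ∈ bag H rank k u, ¬ near (r + r + ρ) u a)
    {c : α → Bool} {cj : ℕ → α → Bool}
    (hcj : ∀ j < k, IsLayerColouring near H rank D j (cj j))
    (hc_near : ∀ u, IsCore near H rank (r + r) k u → ¬ p u → (c u = true ↔ Collar H rank k u))
    (hc_far : ∀ u, ¬ IsCore near H rank (r + r) k u →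
      c u = cj (farLevel near H rank (r + r) k u) u)
    (hC : ∀ {u v : α}, ReflTransGen (fun a b => CoreLink near H rank (r + r) k r' a b ∧
      c a = c b ∧ IsCore near H rank (r + r) k a ∧ IsCore near H rank (r + r) k b) u v →
      near C u v) :
    IsLayerColouring near H rank D k c := by
  have hfar : ∀ {j u a b}, IsFarLevel near H rank (r + r) k j u → b ∈ upper H rank j u →
      a ∈ bag H rank k u → ¬ near r b a := fun hj hb ha hba =>
    hj.2.2 _ (upper_subset_bag hb) _ ha (hn.mono (by omega) hba)
  have hcollar_color : ∀ v, IsFarCollar near H rank (r + r) k v → c v = true := fun v hv => by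
    rw [hc_far v hv.2.1]
    exact (hcj _ (isFarLevel_farLevel hv.1 hv.2.1).1).collar v hv.2.2
  -- Chains outside the core and the far collars stay in one far component.
  have hstay : ∀ u v, rank u ≤ k → ¬ IsCore near H rank (r + r) k u →
      ¬ IsFarCollar near H rank (r + r) k u → H u v → rank v ≤ k → c u = c v →
      rank v ≤ farLevel near H rank (r + r) k u ∧ ¬ IsCore near H rank (r + r) k v ∧
      ¬ IsFarCollar near H rank (r + r) k v ∧
      farLevel near H rank (r + r) k v = farLevel near H rank (r + r) k u := by
    intro u v hu hcu heu huv hv hcol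
    have hf := isFarLevel_farLevel hu hcu
    have hnc : ¬ Collar H rank (farLevel near H rank (r + r) k u) u := fun h => heu ⟨hu, hcu, h⟩
    have hle : rank v ≤ farLevel near H rank (r + r) k u := by
      by_contra hlt
      exact hnc ⟨hf.2.1, v, not_le.1 hlt, huv⟩
    have hconn : ConnLE H rank (farLevel near H rank (r + r) k u) u v := .single huv hf.2.1 hle
    have hlev := farLevel_congr hH hf hconn
    refine ⟨hle, not_isCore_of_far (hf.congr hH hconn), fun hev => ?_, hlev⟩
    have h1 := hcollar_color v hev
    have h2 := (hcj _ hf.1).ring u v hf.2.1 hnc huv (by rw [← hlev]; exact hev.2.2)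
    rw [← hc_far u hcu, hcol, h1] at h2
    cases h2
  let S : α → α → Prop := fun a b => H a b ∧ rank a ≤ k ∧ rank b ≤ k ∧ c a = c b
  have hSsymm : ∀ a b, S a b → S b a := fun a b h => ⟨hH _ _ h.1, h.2.2.1, h.2.1, h.2.2.2.symm⟩
  -- By symmetry of `S`, a chain that can enter the interior of a far component could also leave it,
  -- which `hstay` forbids.
  have hgood : ∀ a b, S a b →
      (IsCore near H rank (r + r) k a ∨ IsFarCollar near H rank (r + r) k a) →
      (IsCore near H rank (r + r) k b ∨ IsFarCollar near H rank (r + r) k b) := by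
    intro a b hab ha
    by_contra hb
    push Not at hb
    have := hstay b a hab.2.2.1 hb.1 hb.2 (hH _ _ hab.1) hab.2.1 hab.2.2.2.symm
    tauto
  -- `Tied v w`: `w` is close to the far collar point `v`.
  let Tied : α → α → Prop := fun v w => ∃ a, H v a ∧
    a ∈ upper H rank (farLevel near H rank (r + r) k v) v ∧
    ChainIn near (r + r + r) (upper H rank (farLevel near H rank (r + r) k v) v) a w
  have hrank : ∀ v, IsFarCollar near H rank (r + r) k v →
      rank v ≤ farLevel near H rank (r + r) k v := fun v hv => hv.2.2.1
  have hchain_symm : ∀ {B : Set α} {a b : α}, ChainIn near (r + r + r) B a b →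
      ChainIn near (r + r + r) B b a := fun h =>
    reflTransGen_symm (fun _ _ h => ⟨h.2.1, h.1, hn.symm h.2.2⟩) h
  have htied_start : ∀ v, IsFarCollar near H rank (r + r) k v → ∃ a, H v a ∧
      a ∈ upper H rank (farLevel near H rank (r + r) k v) v ∧ Tied v a := by
    rintro v hv
    obtain ⟨hle, a, ha, hva⟩ := hv.2.2
    have := mem_upper hle ha hva
    exact ⟨a, hva, this, a, hva, this, .refl⟩
  -- Adjacent collar points belong to the same far component, and their upper neighbours satisfy `a'
  -- - v' - v - a`: a step of length `r + r + r` in its upper boundary. A long run along a collar is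
  -- thus shadowed by a chain in a coverable set, which `B` bounds.
  have htied_step : ∀ v v' w, IsFarCollar near H rank (r + r) k v →
      IsFarCollar near H rank (r + r) k v' → H v v' → Tied v w →
      upper H rank (farLevel near H rank (r + r) k v') v' =
        upper H rank (farLevel near H rank (r + r) k v) v ∧ Tied v' w := by
    rintro v v' w hv hv' hvv' ⟨a, hva, ha, haw⟩
    have hf := isFarLevel_farLevel hv.1 hv.2.1
    have hconn := connLE_of_not_isCore hH hv.1 hv.2.1 hv'.1 hv'.2.1 hvv'
    have hup : upper H rank (farLevel near H rank (r + r) k v') v' =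
        upper H rank (farLevel near H rank (r + r) k v) v := by
      rw [farLevel_congr hH hf hconn, upper_congr hH hconn]
    obtain ⟨a', hva', ha', -⟩ := htied_start v' hv'
    refine ⟨hup, a', hva', ha', ?_⟩
    rw [hup] at ha' ⊢
    exact ReflTransGen.head ⟨ha', ha, hn.trans (hn.trans (hHr _ _ (hH _ _ hva'))
      (hHr _ _ (hH _ _ hvv'))) (hHr _ _ hva)⟩ haw
  have htied_near : ∀ v w, IsFarCollar near H rank (r + r) k v → Tied v w → near (r + B) v w := by
    rintro v w hv ⟨a, hva, -, haw⟩
    exact hn.trans (hHr _ _ hva) (hB (hrank v hv) haw)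
  have htied_core : ∀ v v' w, IsFarCollar near H rank (r + r) k v →
      IsCore near H rank (r + r) k v' → H v v' → Tied v w →
      v' ∈ upper H rank (farLevel near H rank (r + r) k v) v ∧ near B w v' := by
    rintro v v' w hv hv' hvv' ⟨a, hva, ha, haw⟩
    have hup := mem_upper (hrank v hv) (lt_rank_of_isCore hH hv' hv.1 hv.2.1 hvv') hvv'
    refine ⟨hup, hn.symm (hB (hrank v hv) (ReflTransGen.head ⟨hup, ha, ?_⟩ haw))⟩
    exact hn.mono (by omega) (hn.trans (hHr _ _ (hH _ _ hvv')) (hHr _ _ hva))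
  let S' : α → α → Prop := fun a b => CoreLink near H rank (r + r) k r' a b ∧
      c a = c b ∧ IsCore near H rank (r + r) k a ∧ IsCore near H rank (r + r) k b
  -- Chains starting in the core compress to chains of core links.
  have hcore_chain : ∀ u v, IsCore near H rank (r + r) k u → ReflTransGen S u v →
      (IsCore near H rank (r + r) k v ∧ ReflTransGen S' u v) ∨
      (IsFarCollar near H rank (r + r) k v ∧ ∃ w, IsCore near H rank (r + r) k w ∧
        ReflTransGen S' u w ∧ c w = c v ∧
        w ∈ upper H rank (farLevel near H rank (r + r) k v) v ∧ Tied v w) := by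
    intro u v hu huv
    induction huv with
    | refl => exact Or.inl ⟨hu, .refl⟩
    | @tail v v' _ hvv' ih =>
      rcases hgood v v' hvv' (ih.imp And.left And.left) with hv' | hv'
      · refine Or.inl ⟨hv', ?_⟩
        rcases ih with ⟨hv, h⟩ | ⟨hv, w, hw, huw, hcw, hwv, ht⟩
        · exact h.tail ⟨⟨hn.mono hrr' (hHr _ _ hvv'.1), Or.inl hvv'.1⟩, hvv'.2.2.2, hv, hv'⟩
        · obtain ⟨h1, h2⟩ := htied_core v v' w hv hv' hvv'.1 ht
          exact huw.tail ⟨⟨hn.mono hBr' h2, Or.inr ⟨_, v,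
            isFarLevel_farLevel hv.1 hv.2.1, hwv, h1⟩⟩, hcw.trans hvv'.2.2.2, hw, hv'⟩
      · refine Or.inr ⟨hv', ?_⟩
        rcases ih with ⟨hv, h⟩ | ⟨hv, w, hw, huw, hcw, hwv, ht⟩
        · have hHv := hH _ _ hvv'.1
          have hup := mem_upper (hrank v' hv') (lt_rank_of_isCore hH hv hv'.1 hv'.2.1 hHv) hHv
          exact ⟨v, hv, h, hvv'.2.2.2, hup, v, hHv, hup, .refl⟩
        · obtain ⟨h1, h2⟩ := htied_step v v' w hv hv' hvv'.1 ht
          exact ⟨w, hw, huw, hcw.trans hvv'.2.2.2, h1 ▸ hwv, h2⟩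
  have hcore_bound : ∀ u v, IsCore near H rank (r + r) k u → ReflTransGen S u v →
      near (C + (B + r)) u v := by
    intro u v hu huv
    rcases hcore_chain u v hu huv with ⟨-, h⟩ | ⟨hv, w, -, h, -, -, ht⟩
    · exact hn.mono (by omega) (hC h)
    · exact hn.mono (by omega) (hn.trans (hC h) (hn.symm (htied_near v w hv ht)))
  refine ⟨fun u hu => ?_, fun u x huk hu hux hx => ?_, fun u v huv => ?_⟩
  -- A core point of the collar is `r`-close to the top bag, so it was coloured by the collar test.
  -- A point of a far component cannot be in the collar, as `a` would lie in both bags.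
  · obtain ⟨huk, a, hka, hua⟩ := hu
    have ha : a ∈ bag H rank k u := upper_subset_bag (mem_upper huk hka hua)
    by_cases hcu : IsCore near H rank (r + r) k u
    · refine (hc_near u hcu fun h => ?_).2 ⟨huk, a, hka, hua⟩
      exact ((hp u).1 h).2 a ha (hn.mono (by omega) (hHr _ _ hua))
    · have hf := isFarLevel_farLevel huk hcu
      exact absurd (hn.mono (Nat.zero_le _) (hn.refl a))
        (hfar hf (mem_upper hf.2.1 (hf.1.trans hka) hua) ha)
  -- Here `u` is two edges away from the top bag, which is why farness is measured with `r + r`. If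
  -- `u` is in a far component, either `a` or `x` lies in its upper boundary, too close to the top
  -- bag.
  · obtain ⟨hxk, a, hka, hxa⟩ := hx
    have ha : a ∈ bag H rank k u :=
      upper_subset_bag ⟨hka, x, hxk, .single hux huk hxk, hxa⟩
    by_cases hcu : IsCore near H rank (r + r) k u
    · have := hc_near u hcu fun h => ((hp u).1 h).2 a ha
        (hn.mono (by omega) (hn.trans (hHr _ _ hux) (hHr _ _ hxa)))
      rw [← Bool.not_eq_true, this]
      exact hu
    · have hf := isFarLevel_farLevel huk hcu
      by_cases hxj : rank x ≤ farLevel near H rank (r + r) k u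
      · exact absurd (hn.mono (Nat.zero_le _) (hn.refl a))
          (hfar hf ⟨hf.1.trans hka, x, hxj, .single hux hf.2.1 hxj, hxa⟩ ha)
      · exact absurd (hHr _ _ hxa) (hfar hf (mem_upper hf.2.1 (not_le.1 hxj) hux) ha)
  · rcases ReflTransGen.cases_head huv with rfl | ⟨_, h, -⟩
    · exact hn.mono (Nat.zero_le _) (hn.refl _)
    have huk : rank u ≤ k := h.2.1
    clear h
    by_cases hcu : IsCore near H rank (r + r) k u
    · exact hn.mono (by omega) (hcore_bound u v hcu huv)
    by_cases heu : IsFarCollar near H rank (r + r) k u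
    · obtain ⟨a, hua, -, hta⟩ := htied_start u heu
      have : (IsFarCollar near H rank (r + r) k v ∧ Tied v a) ∨
          ∃ w, IsCore near H rank (r + r) k w ∧ near (r + B) u w ∧ ReflTransGen S w v := by
        induction huv with
        | refl => exact Or.inl ⟨heu, hta⟩
        | @tail v v' huv hvv' ih =>
          rcases ih with ⟨hv, ht⟩ | ⟨w, hw, huw, hwv⟩
          · rcases hgood v v' hvv' (Or.inr hv) with hv' | hv'
            · exact Or.inr ⟨v', hv', hn.trans (hHr _ _ hua)
                (htied_core v v' a hv hv' hvv'.1 ht).2, .refl⟩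
            · exact Or.inl ⟨hv', (htied_step v v' a hv hv' hvv'.1 ht).2⟩
          · exact Or.inr ⟨w, hw, huw, hwv.tail hvv'⟩
      rcases this with ⟨hv, ht⟩ | ⟨w, hw, huw, hwv⟩
      · exact hn.mono (by omega) (hn.trans (htied_near u a heu hta)
          (hn.symm (htied_near v a hv ht)))
      · exact hn.mono hD (hn.trans huw (hcore_bound w v hw hwv))
    -- A chain from the interior of a far component never leaves it, so the bound of the lower layer
    -- applies with the same `D`.
    · have hf := isFarLevel_farLevel huk hcu
      have hlay := hcj _ hf.1
      have : (¬ IsCore near H rank (r + r) k v ∧ ¬ IsFarCollar near H rank (r + r) k v ∧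
          rank v ≤ farLevel near H rank (r + r) k u ∧
          farLevel near H rank (r + r) k v = farLevel near H rank (r + r) k u) ∧
          ReflTransGen (fun a b => H a b ∧ rank a ≤ farLevel near H rank (r + r) k u ∧
            rank b ≤ farLevel near H rank (r + r) k u ∧
            cj (farLevel near H rank (r + r) k u) a =
              cj (farLevel near H rank (r + r) k u) b) u v := by
        induction huv with
        | refl => exact ⟨⟨hcu, heu, hf.2.1, rfl⟩, .refl⟩
        | @tail v v' _ hvv' ih =>
          obtain ⟨⟨h1, h2, h3, h4⟩, h5⟩ := ih
          obtain ⟨g1, g2, g3, g4⟩ := hstay v v' hvv'.2.1 h1 h2 hvv'.1 hvv'.2.2.1 hvv'.2.2.2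
          rw [h4] at g1 g4
          refine ⟨⟨g2, g3, g1, g4⟩, h5.tail ⟨hvv'.1, h3, g1, ?_⟩⟩
          have := hvv'.2.2.2
          rwa [hc_far v h1, hc_far v' g2, h4, g4] at this
      exact hlay.bdd u v this.2

end Step

/-- A graph with thin bags has a two-colouring with bounded monochromatic components. -/
theorem exists_colouring_of_hasThinBags (N : ℕ) : ∀ ρ r : ℕ, ∃ D : ℕ, ∀ {α : Type*}
    {near : ℕ → α → α → Prop} (_ : IsNearness near) {H : α → α → Prop}
    (_ : ∀ a b, H a b → H b a) (_ : ∀ a b, H a b → near r a b) {rank : α → ℕ} {k : ℕ}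
    (_ : ∀ a, rank a ≤ k) (_ : HasThinBags near H rank N ρ),
    ∃ c : α → Bool, ∀ u v, ReflTransGen (fun a b => H a b ∧ c a = c b) u v → near D u v := by
  induction N with
  | zero =>
    refine fun ρ r => ⟨0, fun {α near} hn {H} hH hHr {rank k} hk hthin => ⟨fun _ => true, ?_⟩⟩
    intro u
    obtain ⟨g, h, -⟩ := hthin (rank u) u le_rfl
    exact absurd (h u (Or.inl ⟨rfl, .refl⟩)) (Nat.not_lt_zero _)
  | succ N ih =>
    intro ρ r
    -- Core links may have length `r + B`; this is why the induction on `N` must allow an arbitrary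
    -- `r`.
    obtain ⟨B, hB⟩ := exists_chainIn_bound (r + r + r) ρ (N + 1)
    obtain ⟨D, hD⟩ := ih ρ (r + B)
    obtain ⟨C, hC⟩ := exists_core_chain_bound (N + 1) ρ (r + r) (r + B) D
    refine ⟨(r + B) + (C + (B + r)),
      fun {α near} hn {H} hH hHr {rank k} hk hthin => ?_⟩
    have main : ∀ l, ∃ c, IsLayerColouring near H rank ((r + B) + (C + (B + r))) l c := by
      intro l
      induction l using Nat.strong_induction_on with
      | _ l ihl =>
        classical
        choose! cj hcj using ihl
        let p : α → Prop := fun u => IsCore near H rank (r + r) l u ∧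
          ∀ a ∈ bag H rank l u, ¬ near (r + r + ρ) u a
        have hp : ∀ u, p u ↔ IsCore near H rank (r + r) l u ∧
          ∀ a ∈ bag H rank l u, ¬ near (r + r + ρ) u a := fun _ => Iff.rfl
        have hnp : IsNearness fun m (a b : Subtype p) => near m (a : α) b :=
          ⟨fun a => hn.refl _, hn.symm, hn.trans, hn.mono⟩
        obtain ⟨cW, hcW⟩ := hD hnp (H := fun a b : Subtype p =>
          CoreLink near H rank (r + r) l (r + B) a b)
          (fun a b h => ⟨hn.symm h.1, h.2.imp (hH _ _) fun ⟨j, x, h1, h2, h3⟩ =>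
            ⟨j, x, h1, h3, h2⟩⟩)
          (fun a b h => h.1) (k := k) (fun a => hk a) (hasThinBags_core hn hH hthin hp)
        let c : α → Bool := fun u => if hu : p u then cW ⟨u, hu⟩ else
          if IsCore near H rank (r + r) l u then decide (Collar H rank l u)
          else cj (farLevel near H rank (r + r) l u) u
        have hc1 : ∀ u : Subtype p, c u = cW u := fun u => dif_pos u.2
        refine ⟨c, isLayerColouring_of_core hn hH hHr (Nat.le_add_right r B)
          (Nat.le_add_left B r) le_rfl
          (fun {j x} hx {u v} h => hB hn ((hthin j x hx).subset upper_subset_bag) h)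
          hp hcj ?_ ?_ (hC hn hH hthin hp ?_)⟩
        · intro u hu hpu
          simp [c, hpu, hu]
        · intro u hu
          have hpu : ¬ p u := fun h => hu h.1
          simp [c, hpu, hu]
        · intro u v huv
          exact hcW u v (ReflTransGen.mono (fun a b hab => ⟨hab.1, by
            rw [← hc1, ← hc1]; exact hab.2⟩) _ _ huv)
    obtain ⟨c, hc⟩ := main k
    exact ⟨c, fun u v huv => hc.bdd u v
      (ReflTransGen.mono (fun a b hab => ⟨hab.1, hk a, hk b, hab.2⟩) _ _ huv)⟩

/-! ### Coloured clusters from the control function, and walks in intersection graphs -/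

theorem exists_ball_subset_of_lt_lebesgueNumber {X : Type*} [PseudoEMetricSpace X]
    {𝒰 : Set (Set X)} {r : ℝ≥0} (h : (r : ℝ≥0∞) < lebesgueNumber 𝒰) (x : X) :
    ∃ U ∈ 𝒰, Metric.closedEBall x (r : ℝ≥0∞) ⊆ U := by
  unfold lebesgueNumber at h
  obtain ⟨s, hs⟩ := lt_iSup_iff.1 h
  obtain ⟨h1, h2⟩ := lt_iSup_iff.1 hs
  obtain ⟨U, hU, hsub⟩ := h1 x
  exact ⟨U, hU, (Metric.closedEBall_subset_closedEBall h2.le).trans hsub⟩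

/-- Linear control functions give, at every scale `ρ`, a colouring of the points with bounded
labelled clusters such that close points of one colour share a label. -/
theorem exists_clusters_of_isControlFunction {X : Type*} [MetricSpace X] {n : ℕ} {K : ℝ≥0}
    (h : IsControlFunction X n fun r => K * r) : ∃ C : ℝ, 1 ≤ C ∧ ∀ ρ : ℝ, 0 < ρ →
    ∃ (i : X → Fin (n + 1)) (U : X → Set X),
      (∀ x y, i x = i y → dist x y ≤ ρ → U x = U y) ∧ ∀ x y, U x = U y → dist x y ≤ C * ρ := by
  refine ⟨max (2 * K) 1, le_max_right _ _, fun ρ hρ => ?_⟩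
  lift ρ to ℝ≥0 using hρ.le
  have hρ' : 0 < ρ := by exact_mod_cast hρ
  have h2 : 0 < 2 * ρ := by positivity
  -- The Lebesgue number is a supremum that need not be attained; doubling the scale gives a strict
  -- inequality at `ρ`.
  obtain ⟨𝒰, -, hmesh, hleb, hdis⟩ := h (2 * ρ) h2
  have hlt : (ρ : ℝ≥0∞) < lebesgueNumber (⋃ i, 𝒰 i) := by
    refine lt_of_lt_of_le ?_ hleb
    rw [ENNReal.coe_lt_coe]
    exact lt_mul_of_one_lt_left hρ' one_lt_two
  have hball : ∀ x, ∃ i, ∃ U ∈ 𝒰 i, Metric.closedEBall x (ρ : ℝ≥0∞) ⊆ U := by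
    intro x
    obtain ⟨U, hU, hsub⟩ := exists_ball_subset_of_lt_lebesgueNumber hlt x
    obtain ⟨i, hi⟩ := Set.mem_iUnion.1 hU
    exact ⟨i, U, hi, hsub⟩
  choose i U hU hsub using hball
  have hself : ∀ x, x ∈ U x := fun x => hsub x (by simp)
  refine ⟨i, U, fun x y hxy hd => ?_, fun x y hxy => ?_⟩
  · by_contra hne
    have h1 := hU y
    rw [← hxy] at h1
    have hdisj : Disjoint (U x) (U y) := hdis (i x) (hU x) h1 hne
    refine Set.disjoint_left.1 hdisj (hsub x ?_) (hself y)
    rw [Metric.mem_closedEBall, edist_comm, edist_nndist, ENNReal.coe_le_coe]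
    exact_mod_cast hd
  · have hy : y ∈ U x := hxy ▸ hself y
    have h1 : edist x y ≤ ((K * (2 * ρ) : ℝ≥0) : ℝ≥0∞) :=
      (Metric.edist_le_ediam_of_mem (hself x) hy).trans
        ((le_iSup₂_of_le (U x) (Set.mem_iUnion.2 ⟨i x, hU x⟩) le_rfl).trans hmesh)
    rw [edist_nndist, ENNReal.coe_le_coe] at h1
    have h3 : dist x y ≤ K * (2 * ρ) := by exact_mod_cast h1
    have h4 : 2 * (K : ℝ) * ρ ≤ max (2 * (K : ℝ)) 1 * ρ :=
      mul_le_mul_of_nonneg_right (le_max_left _ _) ρ.2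
    linarith

theorem isNearness_edist {V α : Type*} (G : SimpleGraph V) (e : α → V) :
    IsNearness fun k a b => G.edist (e a) (e b) ≤ (k : ℕ∞) where
  refl a := by simp
  symm h := by rwa [G.edist_comm]
  trans h h' := by
    push_cast
    exact SimpleGraph.edist_triangle.trans (add_le_add h h')
  mono hkl h := h.trans (by exact_mod_cast hkl)

theorem exists_walk_of_edist_le {V : Type*} {G : SimpleGraph V} {u v : V} {m : ℕ}
    (h : G.edist u v ≤ (m : ℕ∞)) : ∃ p : G.Walk u v, p.length ≤ m := by
  have hne : G.edist u v ≠ ⊤ := ne_top_of_le_ne_top (ENat.natCast_ne_top m) h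
  obtain ⟨p, hp⟩ := (SimpleGraph.reachable_of_edist_ne_top hne).exists_walk_length_eq_edist
  exact ⟨p, by rw [← hp] at h; exact_mod_cast h⟩

section Walks

variable {X : Type*} [MetricSpace X] {𝒮 : Set (Set X)}

theorem dist_le_of_walk (hfin : ∀ S ∈ 𝒮, Metric.ediam S ≠ ⊤) {s : ℝ} {S T : 𝒮}
    (p : (intersectionGraph 𝒮).Walk S T) (hs : ∀ R ∈ p.support, Metric.diam (R : Set X) ≤ s) :
    ∀ x ∈ (S : Set X), ∀ y ∈ (T : Set X), dist x y ≤ (p.length + 1) * s := by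
  induction p with
  | @nil S =>
    intro x hx y hy
    have := Metric.dist_le_diam_of_mem (Metric.isBounded_iff_ediam_ne_top.2 (hfin S S.2)) hx hy
    have := hs S (by simp)
    simp only [SimpleGraph.Walk.length_nil]
    push_cast
    linarith
  | @cons S R T h p ih =>
    intro x hx y hy
    obtain ⟨z, hzS, hzR⟩ := h.2
    have h1 := Metric.dist_le_diam_of_mem (Metric.isBounded_iff_ediam_ne_top.2 (hfin S S.2)) hx hzS
    have h2 := hs S (by simp)
    have h3 := ih (fun R hR => hs R (by simp [hR])) z hzR y hy
    have h4 := dist_triangle x z y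
    simp only [SimpleGraph.Walk.length_cons]
    push_cast
    linarith

/-- A chain of members ending in a large one reaches a large one close to its start. -/
theorem exists_large_of_walk (hfin : ∀ S ∈ 𝒮, Metric.ediam S ≠ ⊤) {s : ℝ} (hs : 0 ≤ s) {S T : 𝒮}
    (p : (intersectionGraph 𝒮).Walk S T) (hT : s ≤ Metric.diam (T : Set X)) :
    ∀ x ∈ (S : Set X), ∃ R : 𝒮, s ≤ Metric.diam (R : Set X) ∧
      (intersectionGraph 𝒮).edist S R ≤ (p.length : ℕ∞) ∧
      ∃ y ∈ (R : Set X), dist x y ≤ p.length * s := by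
  induction p with
  | @nil S => exact fun x hx => ⟨S, hT, by simp, x, hx, by simp⟩
  | @cons S R T h p ih =>
    intro x hx
    by_cases hS : s ≤ Metric.diam (S : Set X)
    · exact ⟨S, hS, by simp, x, hx, by rw [dist_self]; positivity⟩
    obtain ⟨z, hzS, hzR⟩ := h.2
    have h1 := Metric.dist_le_diam_of_mem (Metric.isBounded_iff_ediam_ne_top.2 (hfin S S.2)) hx hzS
    obtain ⟨R', h2, h3, y, hy, h4⟩ := ih hT z hzR
    refine ⟨R', h2, ?_, y, hy, ?_⟩
    · have := SimpleGraph.edist_le (h.toWalk)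
      simp only [SimpleGraph.Walk.length_cons]
      push_cast
      rw [add_comm]
      refine SimpleGraph.edist_triangle.trans (add_le_add ?_ h3)
      simpa using this
    · have := dist_triangle x z y
      simp only [SimpleGraph.Walk.length_cons]
      push_cast
      linarith

/-- A family of members of diameter at least `s` meeting a common ball is covered by few balls of
the intersection graph. -/
theorem exists_index_of_isSpaceFilling {f : ℝ≥0 → ℕ} (h𝒮 : IsSpaceFilling f 𝒮) {q s : ℝ≥0}
    (hq : 0 < q) (hs : 0 < s) (x : X) (ℛ : Set 𝒮)
    (hℛ : ∀ R ∈ ℛ, (s : ℝ) ≤ Metric.diam (R : Set X) ∧ ∃ y ∈ (R : Set X), dist x y ≤ q * s) :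
    ∃ g : 𝒮 → ℕ, (∀ R ∈ ℛ, g R < f q) ∧ ∀ R ∈ ℛ, ∀ R' ∈ ℛ, g R = g R' →
      (intersectionGraph 𝒮).edist R R' ≤ 2 := by
  -- A maximal disjoint subfamily has at most `f q` members, and by maximality each member of `ℛ` is
  -- one of them or meets one. Members assigned to the same one are at distance at most `2`.
  obtain ⟨𝒯, h𝒯⟩ := zorn_subset {𝒯 : Set (Set X) | 𝒯 ⊆ Subtype.val '' ℛ ∧ 𝒯.PairwiseDisjoint id}
    (fun c hc hchain => ⟨⋃₀ c, ⟨Set.sUnion_subset fun t ht => (hc ht).1,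
      (hchain.pairwiseDisjoint_sUnion id).2 fun t ht => (hc ht).2⟩,
      fun t ht => Set.subset_sUnion_of_mem ht⟩)
  have hcard : 𝒯.encard ≤ (f q : ℕ∞) := by
    have := h𝒮.2 (q * s) s (by positivity) hs x 𝒯 (fun T hT => by
      obtain ⟨R, -, rfl⟩ := h𝒯.prop.1 hT
      exact R.2) h𝒯.prop.2 (fun T hT => by
      obtain ⟨R, hR, rfl⟩ := h𝒯.prop.1 hT
      obtain ⟨h1, y, hy, h2⟩ := hℛ R hR
      refine ⟨⟨y, hy, ?_⟩, ?_⟩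
      · rw [Metric.mem_closedEBall, edist_comm, edist_nndist, ENNReal.coe_le_coe]
        exact_mod_cast h2
      · rw [← ENNReal.ofReal_coe_nnreal]
        exact ENNReal.ofReal_le_of_le_toReal h1)
    rwa [mul_div_cancel_right₀ _ hs.ne'] at this
  have hfin : 𝒯.Finite := Set.finite_of_encard_le_coe hcard
  obtain ⟨φ, hφ, hφinj⟩ : ∃ φ : Set X → ℕ, (∀ T ∈ 𝒯, φ T < f q) ∧ Set.InjOn φ 𝒯 := by
    classical
    have := hfin.fintype
    have hc : Fintype.card 𝒯 ≤ f q := by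
      rw [← Set.coe_fintypeCard] at hcard
      exact_mod_cast hcard
    refine ⟨fun T => if hT : T ∈ 𝒯 then Fintype.equivFin 𝒯 ⟨T, hT⟩ else 0, fun T hT => ?_,
      fun T hT T' hT' he => ?_⟩
    · simp only [hT, dif_pos]
      exact (Fin.is_lt _).trans_le hc
    · simp only [hT, hT', dif_pos] at he
      simpa using (Fintype.equivFin 𝒯).injective (Fin.ext he)
  have hmeet : ∀ R : 𝒮, R ∈ ℛ → ∃ T : 𝒮, (T : Set X) ∈ 𝒯 ∧
      (intersectionGraph 𝒮).edist R T ≤ 1 := by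
    intro R hR
    by_contra hc
    push Not at hc
    have hRT : (R : Set X) ∉ 𝒯 := fun h => by simpa using hc R h
    have hins : insert (R : Set X) 𝒯 ⊆ 𝒯 := by
      refine h𝒯.le_of_ge ⟨Set.insert_subset ⟨R, hR, rfl⟩ h𝒯.prop.1, ?_⟩ (Set.subset_insert _ _)
      refine h𝒯.prop.2.insert fun T hT hne => ?_
      obtain ⟨T, hTℛ, rfl⟩ := h𝒯.prop.1 hT
      rw [id, id, Set.disjoint_iff_inter_eq_empty]
      by_contra hne'
      have hadj : (intersectionGraph 𝒮).Adj R T :=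
        ⟨fun h => hne (congrArg Subtype.val h), Set.nonempty_iff_ne_empty.2 hne'⟩
      exact absurd (SimpleGraph.edist_eq_one_iff_adj.2 hadj).le (not_le.2 (hc T hT))
    exact hRT (hins (Set.mem_insert _ _))
  choose! t ht htd using hmeet
  refine ⟨fun R => φ (t R), fun R hR => hφ _ (ht R hR), fun R hR R' hR' he => ?_⟩
  have : t R = t R' := Subtype.ext (hφinj (ht R hR) (ht R' hR') he)
  calc (intersectionGraph 𝒮).edist R R'
      ≤ (intersectionGraph 𝒮).edist R (t R) + (intersectionGraph 𝒮).edist (t R) R' :=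
        SimpleGraph.edist_triangle
    _ ≤ 1 + 1 := by
        refine add_le_add (htd R hR) ?_
        rw [this, SimpleGraph.edist_comm]
        exact htd R' hR'
    _ = 2 := one_add_one_eq_two

end Walks

/-! ### The colouring of finitely many members: ranks, scales and thin bags -/

/-- Points of rank `k` that are close have a common label, and labels have bounded clusters: then
chains through points of rank less than `k` are short, by induction on `k`. -/
theorem dist_le_of_clustered_chain {α X : Type*} [MetricSpace X] {H : α → α → Prop}
    {rank : α → ℕ} {pt : α → X} {σ : ℕ → ℝ} {C m M : ℝ} {L : ℕ} (hC : 1 ≤ C) (hm : 0 ≤ m)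
    (hM : M = 4 * m) (hσ : ∀ k, 0 < σ k) (hσs : ∀ k, σ (k + 1) = 8 * C * σ k)
    (hlink : ∀ k < L, ∀ u v, H u v → rank u ≤ k → rank v ≤ k → dist (pt u) (pt v) ≤ m * σ k)
    {label : ℕ → α → Set X}
    (hclose : ∀ k, ∀ u v, ReflTransGen H u v → rank u = k → rank v = k →
      dist (pt u) (pt v) ≤ M * σ k → label k u = label k v)
    (hcluster : ∀ k, ∀ u v, rank u = k → rank v = k → label k u = label k v →
      dist (pt u) (pt v) ≤ C * (M * σ k)) :
    ∀ k ≤ L, ∀ u v, ReflTransGen (fun a b => H a b ∧ rank a < k ∧ rank b < k) u v →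
      dist (pt u) (pt v) ≤ M / 4 * σ k := by
  intro k
  induction k with
  | zero =>
    intro _ u v huv
    rcases ReflTransGen.cases_head huv with rfl | ⟨_, h, -⟩
    · rw [dist_self]
      have := hσ 0
      have : 0 ≤ M := by rw [hM]; positivity
      positivity
    · exact absurd h.2.1 (Nat.not_lt_zero _)
  | succ k ih =>
    intro hkL u v huv
    have ih := ih (by omega)
    have hlt : k < L := by omega
    have hσk := hσ k
    have hMn : 0 ≤ M := by rw [hM]; positivity
    have hMσ : 0 ≤ M * σ k := by positivity
    have hCM : M * σ k ≤ C * (M * σ k) := le_mul_of_one_le_left hMσ hC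
    let S : α → α → Prop := fun a b => H a b ∧ rank a < k + 1 ∧ rank b < k + 1
    have hS : ∀ {a b}, S a b → dist (pt a) (pt b) ≤ M / 4 * σ k := fun {a b} h => by
      have := hlink k hlt a b h.1 (by have := h.2.1; omega) (by have := h.2.2; omega)
      rw [hM]
      linarith
    have havoid : ∀ {a b}, ReflTransGen (Avoiding S fun x => rank x = k) a b →
        dist (pt a) (pt b) ≤ M / 4 * σ k := fun h => ih _ _ <|
      ReflTransGen.mono (fun a b (hab : Avoiding S (fun x => rank x = k) a b) =>
        ⟨hab.1.1, by have := hab.1.2.1; have := hab.2.1; omega,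
          by have := hab.1.2.2; have := hab.2.2; omega⟩) _ _ h
    have hH : ∀ {a b}, ReflTransGen (Avoiding S fun x => rank x = k) a b → ReflTransGen H a b :=
      fun h => ReflTransGen.mono (fun a b (hab : Avoiding S (fun x => rank x = k) a b) =>
        hab.1.1) _ _ h
    rw [hσs]
    rcases chain_avoids_or_visits (fun x => rank x = k) huv with
      h | ⟨z, z', hz, hz', h1, h2, h3⟩
    · have h4 := havoid h
      nlinarith
    · have e1 : dist (pt u) (pt z) ≤ M / 2 * σ k := by
        rcases h1 with rfl | ⟨y, hy, hyz⟩
        · rw [dist_self]; positivity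
        · have := dist_triangle (pt u) (pt y) (pt z)
          have := havoid hy
          have := hS hyz
          linarith
      have e3 : dist (pt z') (pt v) ≤ M / 2 * σ k := by
        rcases h3 with rfl | ⟨y, hy, -, hyz⟩
        · rw [dist_self]; positivity
        · have := dist_triangle (pt z') (pt y) (pt v)
          have := havoid hyz
          have := hS hy
          linarith
      -- Between consecutive visits to rank `k` there are two links and a chain of lower rank, each
      -- at most `M / 4 * σ k`. So the visits are `M * σ k`-close and the label never changes.
      have hlab : label k z = label k z' := by
        clear h3 e3 hz'
        induction h2 with
        | refl => rfl
        | @tail a b _ hab ihl =>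
          rw [ihl]
          obtain ⟨ha, hb, hab⟩ := hab
          rcases hab with hab | ⟨y, y', hy, hyy', hy'⟩
          · exact hclose k a b (.single hab.1) ha hb (by linarith [hS hab])
          · refine hclose k a b (((ReflTransGen.single hy.1).trans (hH hyy')).tail hy'.1) ha hb ?_
            have := hS hy
            have := havoid hyy'
            have := hS hy'
            have := dist_triangle4 (pt a) (pt y) (pt y') (pt b)
            linarith
      -- The total `(M / 2 + C * M + M / 2) * σ k` is at most `2 * C * M * σ k = M / 4 * σ (k + 1)`;
      -- this fixes the ratio `8 * C`.
      have e2 := hcluster k z z' hz hz' hlab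
      have := dist_triangle4 (pt u) (pt z) (pt z') (pt v)
      linarith

/-- A finite family of positive reals has a positive lower bound. -/
theorem exists_pos_le_of_finite {α : Type*} [Finite α] {g : α → ℝ} (hg : ∀ a, 0 < g a) :
    ∃ β : ℝ, 0 < β ∧ ∀ a, β ≤ g a := by
  cases isEmpty_or_nonempty α
  · exact ⟨1, one_pos, fun a => isEmptyElim a⟩
  · obtain ⟨a, ha⟩ := Finite.exists_min g
    exact ⟨g a, hg a, ha⟩

/-- The main colouring, for finitely many members of positive diameter. -/
theorem exists_finite_colouring {X : Type*} [MetricSpace X] {n : ℕ} {K : ℝ≥0}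
    (h : IsControlFunction X n fun r => K * r) (f : ℝ≥0 → ℕ) (r : ℕ) : ∃ D : ℕ,
    ∀ {𝒮 : Set (Set X)} (_ : IsSpaceFilling f 𝒮) {α : Type*} [Finite α] (e : α → 𝒮)
    (_ : ∀ a, Metric.ediam (e a : Set X) ≠ 0), ∃ c : α → Fin (n + 1) × Bool, ∀ u v,
    ReflTransGen (fun a b => (intersectionGraph 𝒮).edist (e a) (e b) ≤ (r : ℕ∞) ∧ c a = c b) u v →
      (intersectionGraph 𝒮).edist (e u) (e v) ≤ (D : ℕ∞) := by
  obtain ⟨C, hC, hclus⟩ := exists_clusters_of_isControlFunction h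
  let m : ℝ := (r + 1) * (8 * C)
  let M : ℝ := 4 * m
  have hm : 0 < m := by positivity
  have hM : 0 < M := by positivity
  -- In units of `σ k`: `2 * C * M` bounds a component of rank at most `k`, and `2 * r` a walk
  -- through members smaller than `σ k`.
  let q : ℝ≥0 := Real.toNNReal (2 * C * M + 2 * r)
  have hqr : (q : ℝ) = 2 * C * M + 2 * r := Real.coe_toNNReal _ (by positivity)
  have hq : 0 < q := Real.toNNReal_pos.2 (by positivity)
  obtain ⟨D, hD⟩ := exists_colouring_of_hasThinBags (f q) (3 * r + 2 + 3 * r) r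
  refine ⟨D, fun {𝒮} h𝒮 {α} _ e he => ?_⟩
  have hdiam : ∀ a, 0 < Metric.diam (e a : Set X) := fun a =>
    ENNReal.toReal_pos (he a) (h𝒮.1 _ (e a).2)
  have hne : ∀ a, (e a : Set X).Nonempty := fun a => by
    rw [Set.nonempty_iff_ne_empty]
    intro h0
    have := he a
    rw [h0] at this
    simp at this
  choose pt hpt using hne
  obtain ⟨β, hβ, hβle⟩ := exists_pos_le_of_finite hdiam
  let σ : ℕ → ℝ := fun k => β * (8 * C) ^ k
  have hσ : ∀ k, 0 < σ k := fun k => by positivity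
  have hσs : ∀ k, σ (k + 1) = 8 * C * σ k := fun k => by simp only [σ, pow_succ]; ring
  have hσmono : Monotone σ := monotone_nat_of_le_succ fun k => by
    rw [hσs]
    nlinarith [hσ k]
  -- Ranks are capped at a scale exceeding all distances between chosen points. At rank `L` members
  -- may be arbitrarily large, and this bound replaces the cluster argument.
  obtain ⟨L, hL⟩ : ∃ L, ∀ u v, dist (pt u) (pt v) ≤ σ L := by
    obtain ⟨B, hB⟩ := (Set.finite_range fun p : α × α => dist (pt p.1) (pt p.2)).bddAbove
    obtain ⟨L, hL⟩ := pow_unbounded_of_one_lt (B / β) (show 1 < 8 * C by linarith)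
    refine ⟨L, fun u v => (hB ⟨(u, v), rfl⟩).trans ?_⟩
    rw [div_lt_iff₀ hβ] at hL
    simp only [σ]
    linarith
  classical
  let P : α → ℕ → Prop := fun a j => ∃ T : 𝒮,
    (intersectionGraph 𝒮).edist (e a) T ≤ (r : ℕ∞) ∧ σ j ≤ Metric.diam (T : Set X)
  -- The rank looks at the whole `r`-ball, so that every member on a walk of length `r` from a
  -- vertex of rank `k < L` has diameter below `σ (k + 1)`.
  let rank : α → ℕ := fun a => Nat.findGreatest (P a) L
  have hrankL : ∀ a, rank a ≤ L := fun a => Nat.findGreatest_le L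
  have hrankP : ∀ a, P a (rank a) := fun a =>
    Nat.findGreatest_spec (m := 0) (Nat.zero_le L) ⟨e a, by simp, by simpa [σ] using hβle a⟩
  have hrank_lt : ∀ a j, rank a < j → j ≤ L → ∀ T : 𝒮,
      (intersectionGraph 𝒮).edist (e a) T ≤ (r : ℕ∞) → Metric.diam (T : Set X) < σ j :=
    fun a j h1 h2 T hT => by
      by_contra hc
      exact Nat.findGreatest_is_greatest h1 h2 ⟨T, hT, not_lt.1 hc⟩
  choose col lab hcol hlab using fun k => hclus (M * σ k) (mul_pos hM (hσ k))
  let c₀ : α → Fin (n + 1) := fun a => col (rank a) (pt a)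
  let near : ℕ → α → α → Prop := fun k a b =>
    (intersectionGraph 𝒮).edist (e a) (e b) ≤ (k : ℕ∞)
  have hn : IsNearness near := isNearness_edist _ e
  let H : α → α → Prop := fun a b => near r a b ∧ c₀ a = c₀ b
  have hlink : ∀ k < L, ∀ u v, H u v → rank u ≤ k → rank v ≤ k →
      dist (pt u) (pt v) ≤ m * σ k := by
    intro k hk u v huv hu _
    obtain ⟨p, hp⟩ := exists_walk_of_edist_le huv.1
    have h1 := dist_le_of_walk h𝒮.1 p (s := σ (k + 1)) (fun R hR => by
      refine (hrank_lt u (k + 1) (by omega) hk R ?_).le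
      refine (SimpleGraph.edist_le (p.takeUntil R hR)).trans ?_
      exact_mod_cast (p.length_takeUntil_le_length hR).trans hp) _ (hpt u) _ (hpt v)
    rw [hσs] at h1
    have h2 : ((p.length : ℝ) + 1) ≤ r + 1 := by
      have : (p.length : ℝ) ≤ r := by exact_mod_cast hp
      linarith
    calc dist (pt u) (pt v) ≤ (p.length + 1) * (8 * C * σ k) := h1
      _ ≤ (r + 1) * (8 * C * σ k) :=
        mul_le_mul_of_nonneg_right h2 (by have := hσ k; positivity)
      _ = m * σ k := by simp only [m]; ring
  have hcolour : ∀ u v, ReflTransGen H u v → c₀ u = c₀ v := by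
    intro u v huv
    induction huv with
    | refl => rfl
    | tail _ h ih => exact ih.trans h.2
  have hchain := dist_le_of_clustered_chain (H := H) (rank := rank) (pt := pt) (σ := σ)
    (label := fun k a => lab k (pt a)) (L := L) hC hm.le rfl hσ hσs hlink
    (fun k u v huv hu hv hd => hcol k _ _ (by
      have := hcolour u v huv
      simp only [c₀, hu, hv] at this
      exact this) hd)
    (fun k u v _ _ huv => hlab k _ _ huv)
  have hconn : ∀ k ≤ L, ∀ u v, ConnLE H rank k u v → dist (pt u) (pt v) ≤ 2 * C * M * σ k := by
    intro k hk u v huv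
    have hσk := hσ k
    rcases hk.lt_or_eq with hk | rfl
    · have := hchain (k + 1) hk u v (ReflTransGen.mono (fun a b hab =>
        ⟨hab.1, Nat.lt_succ_of_le hab.2.1, Nat.lt_succ_of_le hab.2.2⟩) _ _ huv)
      rw [hσs] at this
      linarith
    · refine (hL u v).trans (le_mul_of_one_le_left hσk.le ?_)
      have : 1 ≤ M := by simp only [M, m]; nlinarith [(Nat.cast_nonneg r : (0 : ℝ) ≤ r)]
      nlinarith
  have hlarge : ∀ k ≤ L, ∀ u v, v ∈ bag H rank k u → ∃ R : 𝒮, σ k ≤ Metric.diam (R : Set X) ∧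
      (intersectionGraph 𝒮).edist (e v) R ≤ ((3 * r : ℕ) : ℕ∞) ∧
      ∃ y ∈ (R : Set X), dist (pt u) y ≤ q * σ k := by
    intro k hk u v hv
    have hσk := hσ k
    obtain ⟨T, hvT, hT⟩ := hrankP v
    have hkv : k ≤ rank v := by
      rcases hv with h | h
      · exact h.1.ge
      · exact h.1.le
    obtain ⟨w, hw, hvw⟩ : ∃ w, ConnLE H rank k u w ∧ near r w v := by
      rcases hv with h | ⟨_, w, _, h1, h2⟩
      · exact ⟨v, h.2, hn.mono (Nat.zero_le _) (hn.refl v)⟩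
      · exact ⟨w, h1, h2.1⟩
    have hwT : (intersectionGraph 𝒮).edist (e w) T ≤ ((r + r : ℕ) : ℕ∞) := by
      push_cast
      exact SimpleGraph.edist_triangle.trans (add_le_add hvw hvT)
    -- The chosen point of `v` may be far away in `X`, since `v` may have large rank. Walking from
    -- `w` towards `T` until the first member of size `σ k` gives one near `pt u`.
    obtain ⟨p, hp⟩ := exists_walk_of_edist_le hwT
    obtain ⟨R, h1, h2, y, hy, h3⟩ :=
      exists_large_of_walk h𝒮.1 hσk.le p ((hσmono hkv).trans hT) _ (hpt w)
    refine ⟨R, h1, ?_, y, hy, ?_⟩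
    · have h4 : (intersectionGraph 𝒮).edist (e w) R ≤ ((r + r : ℕ) : ℕ∞) :=
        h2.trans (by exact_mod_cast hp)
      have h5 := SimpleGraph.edist_triangle.trans (add_le_add (hn.symm hvw) h4)
      refine h5.trans ?_
      norm_cast
      omega
    · have h4 : (p.length : ℝ) ≤ r + r := by exact_mod_cast hp
      have h5 : p.length * σ k ≤ (r + r) * σ k := mul_le_mul_of_nonneg_right h4 hσk.le
      have h6 := dist_triangle (pt u) (pt w) y
      have h7 := hconn k hk u w hw
      rw [hqr]
      linarith
  have hthin : HasThinBags near H rank (f q) (3 * r + 2 + 3 * r) := by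
    intro k u hu
    by_cases hk : k ≤ L
    · have hlarge := hlarge k hk u
      have : Nonempty 𝒮 := ⟨e u⟩
      choose! R hR1 hR2 hR3 using hlarge
      obtain ⟨g, hg1, hg2⟩ := exists_index_of_isSpaceFilling h𝒮 hq (s := ⟨σ k, (hσ k).le⟩) (hσ k)
        (pt u) (R '' bag H rank k u) (by
          rintro _ ⟨v, hv, rfl⟩
          exact ⟨hR1 v hv, hR3 v hv⟩)
      refine ⟨fun v => g (R v), fun v hv => hg1 _ ⟨v, hv, rfl⟩, fun v hv w hw hvw => ?_⟩
      have h1 := hg2 _ ⟨v, hv, rfl⟩ _ ⟨w, hw, rfl⟩ hvw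
      have h2 := hR2 w hw
      rw [SimpleGraph.edist_comm] at h2
      have h3 := SimpleGraph.edist_triangle.trans
        (add_le_add (SimpleGraph.edist_triangle.trans (add_le_add (hR2 v hv) h1)) h2)
      refine h3.trans ?_
      norm_cast
    · refine (coverable_empty near _ _).subset ?_
      rintro v (⟨h1, -⟩ | ⟨h1, -⟩)
      · exact hk (h1 ▸ hrankL v)
      · exact hk (h1.le.trans (hrankL v))
  obtain ⟨c, hc⟩ := hD hn (H := H) (fun a b hab => ⟨hn.symm hab.1, hab.2.symm⟩)
    (fun a b hab => hab.1) hrankL hthin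
  refine ⟨fun a => (c₀ a, c a), fun u v huv => hc u v (ReflTransGen.mono (fun a b hab => ?_) _ _ huv)⟩
  have := Prod.mk.inj hab.2
  exact ⟨⟨hab.1, this.1⟩, this.2⟩

/-! ### Compactness, colourings and asymptotic dimension, members of zero diameter -/

theorem exists_finset_chain {α : Type*} {S : α → α → Prop} {u v : α} (h : ReflTransGen S u v) :
    ∃ (s : Finset α) (hu : u ∈ s) (hv : v ∈ s),
      ReflTransGen (fun a b : s => S a b) ⟨u, hu⟩ ⟨v, hv⟩ := by
  classical
  induction h with
  | refl => exact ⟨{u}, by simp, by simp, .refl⟩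
  | @tail v w _ hvw ih =>
    obtain ⟨s, hu, hv, h⟩ := ih
    refine ⟨insert w s, by simp [hu], by simp, ?_⟩
    have h' : ReflTransGen (fun a b : (insert w s : Finset α) => S a b)
        (Set.inclusion (Finset.subset_insert w s) ⟨u, hu⟩)
        (Set.inclusion (Finset.subset_insert w s) ⟨v, hv⟩) :=
      ReflTransGen.lift _ (fun a b hab => hab) _ _ h
    exact h'.tail hvw

/-- Compactness: colourings with controlled monochromatic chains exist if they exist on all finite
subsets. -/
theorem exists_colouring_of_finite {α β : Type*} [Finite β] {S Q : α → α → Prop}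
    (h : ∀ s : Finset α, ∃ c : s → β, ∀ u v : s,
      ReflTransGen (fun a b : s => S a b ∧ c a = c b) u v → Q u v) :
    ∃ c : α → β, ∀ u v, ReflTransGen (fun a b => S a b ∧ c a = c b) u v → Q u v := by
  choose g hg using h
  obtain ⟨χ, hχ⟩ := Finset.rado_selection_subtype (β := fun _ => β) g
  refine ⟨χ, fun u v huv => ?_⟩
  obtain ⟨s, hu, hv, h⟩ := exists_finset_chain huv
  obtain ⟨t, hst, ht⟩ := hχ s
  refine hg t (Set.inclusion hst ⟨u, hu⟩) (Set.inclusion hst ⟨v, hv⟩)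
    (ReflTransGen.lift (Set.inclusion hst) (fun a b hab => ⟨hab.1, ?_⟩) _ _ h)
  rw [← ht, ← ht]
  exact hab.2

/-- The cover consists of the `R`-neighbourhoods of monochromatic chain components at scale `R + R`:
if two of one colour meet, their components contain points `R + R`-close, hence coincide. -/
theorem asdim_le_of_colouring {X : Type*} [PseudoEMetricSpace X] {m : ℕ}
    (h : ∀ r : ℕ, ∃ D : ℕ, ∃ c : X → Fin (m + 1), ∀ u v,
      ReflTransGen (fun a b => edist a b ≤ (r : ℝ≥0∞) ∧ c a = c b) u v →
        edist u v ≤ (D : ℝ≥0∞)) : asdim X ≤ m := by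
  choose D c hc using h
  refine iInf₂_le m ⟨fun r => ⌈r⌉₊ + D (⌈r⌉₊ + ⌈r⌉₊) + ⌈r⌉₊, fun r _ => ?_⟩
  set R := ⌈r⌉₊
  have hrR : (r : ℝ≥0∞) ≤ (R : ℝ≥0∞) := by exact_mod_cast Nat.le_ceil r
  let chain : X → X → Prop :=
    ReflTransGen fun a b => edist a b ≤ ((R + R : ℕ) : ℝ≥0∞) ∧ c (R + R) a = c (R + R) b
  have hcol : ∀ {u v}, chain u v → c (R + R) u = c (R + R) v := fun h => by
    induction h with
    | refl => rfl
    | tail _ h ih => exact ih.trans h.2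
  have hsymm : ∀ {u v}, chain u v → chain v u := fun h =>
    reflTransGen_symm (fun a b hab => ⟨by rw [edist_comm]; exact hab.1, hab.2.symm⟩) h
  let V : X → Set X := fun u => {x | ∃ v, chain u v ∧ edist x v ≤ (R : ℝ≥0∞)}
  have hball : ∀ x, Metric.closedEBall x (r : ℝ≥0∞) ⊆ V x := fun x y hy =>
    ⟨x, .refl, (Metric.mem_closedEBall.1 hy).trans hrR⟩
  have hmem : ∀ x, V x ∈ ⋃ i, {W | ∃ u, c (R + R) u = i ∧ W = V u} := fun x =>
    Set.mem_iUnion.2 ⟨_, x, rfl, rfl⟩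
  refine ⟨fun i => {W | ∃ u, c (R + R) u = i ∧ W = V u}, ?_, ?_, ?_, ?_⟩
  · exact Set.eq_univ_of_forall fun x => ⟨V x, hmem x, hball x (by simp)⟩
  · refine iSup₂_le fun W hW => ?_
    obtain ⟨i, u, -, rfl⟩ := Set.mem_iUnion.1 hW
    refine Metric.ediam_le fun x hx y hy => ?_
    obtain ⟨v, huv, hxv⟩ := hx
    obtain ⟨w, huw, hyw⟩ := hy
    have h1 := hc _ v w ((hsymm huv).trans huw)
    rw [edist_comm] at hyw
    push_cast
    exact (edist_triangle4 x v w y).trans (add_le_add (add_le_add hxv h1) hyw)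
  · exact le_iSup₂_of_le r (fun x => ⟨V x, hmem x, hball x⟩) le_rfl
  · rintro i _ ⟨u, hu, rfl⟩ _ ⟨u', hu', rfl⟩ hne
    refine Set.disjoint_left.2 fun x hx hx' => hne ?_
    obtain ⟨v, huv, hxv⟩ := hx
    obtain ⟨v', huv', hxv'⟩ := hx'
    have hvv' : chain v v' := by
      refine .single ⟨?_, ?_⟩
      · push_cast
        rw [edist_comm] at hxv
        exact (edist_triangle v x v').trans (add_le_add hxv hxv')
      · rw [← hcol huv, ← hcol huv', hu, hu']
    have huu' : chain u u' := (huv.trans hvv').trans (hsymm huv')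
    ext y
    exact ⟨fun ⟨w, h1, h2⟩ => ⟨w, (hsymm huu').trans h1, h2⟩,
      fun ⟨w, h1, h2⟩ => ⟨w, huu'.trans h1, h2⟩⟩

/-- A nonisolated member of zero diameter is adjacent to a member of nonzero diameter. -/
theorem exists_adj_of_ediam_eq_zero {X : Type*} [MetricSpace X] {𝒮 : Set (Set X)} {S T : 𝒮}
    (hS : Metric.ediam (S : Set X) = 0) {m : ℕ}
    (h : (intersectionGraph 𝒮).edist S T ≤ (m : ℕ∞)) (hne : S ≠ T) :
    ∃ R : 𝒮, Metric.ediam (R : Set X) ≠ 0 ∧ (intersectionGraph 𝒮).Adj S R := by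
  obtain ⟨p, -⟩ := exists_walk_of_edist_le h
  cases p with
  | nil => exact absurd rfl hne
  | @cons _ R _ hadj _ =>
    refine ⟨R, fun hR => hadj.1 (Subtype.ext ?_), hadj⟩
    obtain ⟨z, hzS, hzR⟩ := hadj.2
    rw [Metric.ediam_eq_zero_iff] at hS hR
    rw [hS.eq_singleton_of_mem hzS, hR.eq_singleton_of_mem hzR]

theorem exists_intersectionGraph_colouring {X : Type*} [MetricSpace X] {n : ℕ} {K : ℝ≥0}
    (h : IsControlFunction X n fun r => K * r) (f : ℝ≥0 → ℕ) (r : ℕ) : ∃ D : ℕ,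
    ∀ {𝒮 : Set (Set X)} (_ : IsSpaceFilling f 𝒮), ∃ c : 𝒮 → Fin (n + 1) × Bool, ∀ u v,
    ReflTransGen (fun a b => (intersectionGraph 𝒮).edist a b ≤ (r : ℕ∞) ∧ c a = c b) u v →
      (intersectionGraph 𝒮).edist u v ≤ (D : ℕ∞) := by
  -- Each vertex that is not isolated is replaced by a member of positive diameter at distance at
  -- most `1`, lengthening steps by `2`. Positivity gives each finite subfamily a smallest scale,
  -- and `D` does not depend on the subfamily.
  obtain ⟨D, hD⟩ := exists_finite_colouring h f (1 + r + 1)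
  refine ⟨1 + D + 1, fun {𝒮} h𝒮 => ?_⟩
  let G := intersectionGraph 𝒮
  let A := {S : 𝒮 // Metric.ediam (S : Set X) ≠ 0}
  have hn : IsNearness fun k (a b : 𝒮) => G.edist a b ≤ (k : ℕ∞) := isNearness_edist G id
  obtain ⟨c, hc⟩ := exists_colouring_of_finite (α := A) (β := Fin (n + 1) × Bool)
    (S := fun a b => G.edist a b ≤ ((1 + r + 1 : ℕ) : ℕ∞))
    (Q := fun a b => G.edist a b ≤ (D : ℕ∞))
    fun s => hD h𝒮 (fun a : s => (a : A).1) fun a => (a : A).2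
  have hrep : ∀ S : 𝒮, (∃ a : A, G.edist S a ≤ ((1 : ℕ) : ℕ∞)) ∨
      ∀ (m : ℕ) (T : 𝒮), G.edist S T ≤ (m : ℕ∞) → S = T := by
    intro S
    by_cases hS : Metric.ediam (S : Set X) = 0
    · refine or_iff_not_imp_right.2 fun hT => ?_
      push Not at hT
      obtain ⟨m, T, h1, h2⟩ := hT
      obtain ⟨R, hR, hadj⟩ := exists_adj_of_ediam_eq_zero hS h1 h2
      exact ⟨⟨R, hR⟩, by rw [SimpleGraph.edist_eq_one_iff_adj.2 hadj]; simp⟩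
    · exact Or.inl ⟨⟨S, hS⟩, by simp⟩
  have hopt : ∀ S : 𝒮, ∃ o : Option A, (∀ a, o = some a → G.edist S a ≤ ((1 : ℕ) : ℕ∞)) ∧
      (o = none → ∀ (m : ℕ) (T : 𝒮), G.edist S T ≤ (m : ℕ∞) → S = T) := by
    intro S
    rcases hrep S with ⟨a, ha⟩ | h
    · exact ⟨some a, fun b hb => Option.some.inj hb ▸ ha, fun h => by cases h⟩
    · exact ⟨none, fun b hb => (by cases hb), fun _ => h⟩
  choose π hπ hπ' using hopt
  -- The colour of an isolated vertex is arbitrary: it has no other vertex at finite distance.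
  refine ⟨fun S => (π S).elim (0, true) c, fun u v huv => ?_⟩
  have key : u = v ∨ ∃ a b, π u = some a ∧ π v = some b ∧
      ReflTransGen (fun a b : A => G.edist a b ≤ ((1 + r + 1 : ℕ) : ℕ∞) ∧ c a = c b) a b := by
    induction huv with
    | refl => exact Or.inl rfl
    | @tail v w _ hvw ih =>
      cases hv : π v with
      | none => exact hπ' v hv r w hvw.1 ▸ ih
      | some b =>
        cases hw : π w with
        | none =>
          have hwv : G.edist w v ≤ (r : ℕ∞) := hn.symm hvw.1
          rw [hπ' w hw r v hwv, hv] at hw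
          cases hw
        | some d =>
          have hbd : G.edist b d ≤ ((1 + r + 1 : ℕ) : ℕ∞) ∧ c b = c d := by
            refine ⟨hn.trans (hn.trans (hn.symm (hπ v b hv)) hvw.1) (hπ w d hw), ?_⟩
            have : (π v).elim (0, true) c = (π w).elim (0, true) c := hvw.2
            rwa [hv, hw] at this
          rcases ih with rfl | ⟨a, b', ha, hb', hab⟩
          · exact Or.inr ⟨b, d, hv, rfl, .single hbd⟩
          · rw [hv, Option.some.injEq] at hb'
            exact Or.inr ⟨a, d, ha, rfl, (hb' ▸ hab).tail hbd⟩
  rcases key with rfl | ⟨a, b, ha, hb, hab⟩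
  · exact hn.mono (Nat.zero_le _) (hn.refl u)
  · exact hn.trans (hn.trans (hπ u a ha) (hc a b hab)) (hn.symm (hπ v b hb))

/-! ### Passage to the disjoint union and conclusion -/

section DisjointUnion

variable {ι : Type*} {V : ι → Type*} {G : ∀ i, SimpleGraph (V i)}

theorem exists_edist_le_of_disjointUnion {m : ℕ} {i : ι} {u : V i} {b : Σ i, V i}
    (h : (disjointUnion G).edist ⟨i, u⟩ b ≤ (m : ℕ∞)) :
    ∃ v : V i, b = ⟨i, v⟩ ∧ (G i).edist u v ≤ (m : ℕ∞) := by
  have walk : ∀ {a b : Σ i, V i} (p : (disjointUnion G).Walk a b),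
      ∃ v : V a.1, b = ⟨a.1, v⟩ ∧ (G a.1).edist a.2 v ≤ (p.length : ℕ∞) := by
    intro a b p
    induction p with
    | @nil a => exact ⟨a.2, rfl, by simp⟩
    | @cons a b d hadj p ih =>
      obtain ⟨j, hj⟩ := SimpleGraph.iSup_adj.1 hadj
      obtain ⟨x, y, hxy, rfl, rfl⟩ := (SimpleGraph.map_adj _ _ _ _).1 hj
      obtain ⟨v, rfl, hv⟩ := ih
      refine ⟨v, rfl, ?_⟩
      simp only [SimpleGraph.Walk.length_cons]
      push_cast
      rw [add_comm]
      exact SimpleGraph.edist_triangle.trans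
        (add_le_add (SimpleGraph.edist_eq_one_iff_adj.2 hxy).le hv)
  obtain ⟨p, hp⟩ := exists_walk_of_edist_le h
  obtain ⟨v, h1, h2⟩ := walk p
  exact ⟨v, h1, h2.trans (by exact_mod_cast hp)⟩

theorem disjointUnion_edist_le {m : ℕ} {i : ι} {u v : V i} (h : (G i).edist u v ≤ (m : ℕ∞)) :
    (disjointUnion G).edist ⟨i, u⟩ ⟨i, v⟩ ≤ (m : ℕ∞) := by
  obtain ⟨p, hp⟩ := exists_walk_of_edist_le h
  let φ : G i →g disjointUnion G := ⟨fun u => ⟨i, u⟩, fun {a b} hab =>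
    SimpleGraph.iSup_adj.2 ⟨i, (SimpleGraph.map_adj _ _ _ _).2 ⟨a, b, hab, rfl, rfl⟩⟩⟩
  refine (SimpleGraph.edist_le (p.map φ)).trans ?_
  rw [SimpleGraph.Walk.length_map]
  exact_mod_cast hp

theorem graphClassAsdim_le_of_colouring {m : ℕ} {β : Type*} [Fintype β]
    (hβ : Fintype.card β = m + 1)
    (h : ∀ r : ℕ, ∃ D : ℕ, ∀ i, ∃ c : V i → β, ∀ u v,
      ReflTransGen (fun a b => (G i).edist a b ≤ (r : ℕ∞) ∧ c a = c b) u v →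
        (G i).edist u v ≤ (D : ℕ∞)) : graphClassAsdim G ≤ m := by
  refine @asdim_le_of_colouring _ (graphMetric (disjointUnion G)) m fun r => ?_
  have hcast : ∀ (a b : Σ i, V i) (k : ℕ),
      @edist _ (graphMetric (disjointUnion G)).toEDist a b ≤ (k : ℝ≥0∞) ↔
        (disjointUnion G).edist a b ≤ (k : ℕ∞) := fun a b k => by
    rw [← ENat.toENNReal_le, ENat.toENNReal_coe]
    rfl
  obtain ⟨D, hD⟩ := h r
  choose c hc using hD
  let φ := Fintype.equivFinOfCardEq hβ
  refine ⟨D, fun a => φ (c a.1 a.2), fun ⟨i, u⟩ b hub => ?_⟩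
  have : ∃ v : V i, b = ⟨i, v⟩ ∧
      ReflTransGen (fun a b => (G i).edist a b ≤ (r : ℕ∞) ∧ c i a = c i b) u v := by
    induction hub with
    | refl => exact ⟨u, rfl, .refl⟩
    | tail _ h ih =>
      obtain ⟨v, rfl, hv⟩ := ih
      obtain ⟨w, rfl, hw⟩ := exists_edist_le_of_disjointUnion ((hcast _ _ _).1 h.1)
      exact ⟨w, rfl, hv.tail ⟨hw, φ.injective h.2⟩⟩
  obtain ⟨v, rfl, hv⟩ := this
  exact (hcast _ _ _).2 (disjointUnion_edist_le (hc i u v hv))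

end DisjointUnion

theorem exists_isControlFunction_of_asdimAN_eq {X : Type*} [PseudoEMetricSpace X] {n : ℕ}
    (h : asdimAN X = n) : ∃ K : ℝ≥0, 1 < K ∧ IsControlFunction X n fun r => K * r := by
  by_contra hc
  have hlt : asdimAN X < ((n + 1 : ℕ) : ℕ∞) := by
    rw [h]
    exact_mod_cast n.lt_succ_self
  unfold asdimAN at hlt
  obtain ⟨k, hk⟩ := iInf_lt_iff.1 hlt
  obtain ⟨hK, hk⟩ := iInf_lt_iff.1 hk
  have h1 : asdimAN X ≤ k := iInf₂_le k hK
  have h2 : k < n + 1 := by exact_mod_cast hk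
  have h3 : n ≤ k := by rw [h] at h1; exact_mod_cast h1
  obtain rfl : k = n := by omega
  exact hc hK

end CoarseDim

theorem theorem2 {X : Type*} [MetricSpace X] (n : ℕ) (hX : CoarseDim.asdimAN X = n)
    (f : ℝ≥0 → ℕ) :
    CoarseDim.graphClassAsdim
      (fun 𝒮 : {𝒮 : Set (Set X) // CoarseDim.IsSpaceFilling f 𝒮} =>
        CoarseDim.intersectionGraph 𝒮.1) ≤ 2 * n + 1 := by
  obtain ⟨K, -, hK⟩ := CoarseDim.exists_isControlFunction_of_asdimAN_eq hX
  have := CoarseDim.graphClassAsdim_le_of_colouring (m := 2 * n + 1)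
    (G := fun 𝒮 : {𝒮 : Set (Set X) // CoarseDim.IsSpaceFilling f 𝒮} =>
        CoarseDim.intersectionGraph 𝒮.1) (β := Fin (n + 1) × Bool) (by simp; ring) fun r => by
      obtain ⟨D, hD⟩ := CoarseDim.exists_intersectionGraph_colouring hK f r
      exact ⟨D, fun 𝒮 => hD 𝒮.2⟩
  exact_mod_cast this
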